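/- Let $k$ be a perfect field of characteristic $p>0$, let $W_2(k)$ be the ring of $p$-typical Witt vectors of length two over $k$, and let $\sigma$ be its Frobenius $(a_0,a_1)\mapsto(a_0^p,a_1^p)$. Let $X$ be a normal scheme (all local rings are integrally closed domains), locally of finite type over $k$, with absolute Frobenius $F_X\colon X\to X$ (the identity on the underlying space and $s\mapsto s^p$ on sections). Suppose that there exist - a lifting of $X$ to $W_2(k)$, i.e. a flat morphism $\widetilde X\to \operatorname{Spec} W_2(k)$ together with an isomorphism $\widetilde X\times_{\operatorname{Spec} W_2(k)}\operatorname{Spec} k\simeq X$ over $k$, and - a lifting of Frobenius to it, i.e. a morphism $\widetilde F\colon\widetilde X\to\widetilde X$ lying over $\operatorname{Spec}(\sigma)$ and satisfying $\widetilde F\circ i=i\circ F_X$, where $i\colon X\to\widetilde X$ is the resulting closed immersion. Then $X$ is Frobenius split: there is a homomorphism of $\mathcal O_X$-modules $\varphi\colon F_{X*}\mathcal O_X\to\mathcal O_X$ such that $\varphi\circ F_X^{\#}=\mathrm{id}_{\mathcal O_X}$, where $F_X^{\#}\colon\mathcal O_X\to F_{X*}\mathcal O_X$ is the canonical map. -/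

import Mathlib

open CategoryTheory AlgebraicGeometry

universe u

noncomputable section

namespace FrobLift

/-! ### Normal schemes -/

/-- A scheme is normal if all its local rings are integrally closed domains. -/
class IsNormalScheme (X : Scheme.{u}) : Prop where
  isDomain_stalk : ∀ x : X, IsDomain (X.presheaf.stalk x)
  isIntegrallyClosed_stalk : ∀ x : X, IsIntegrallyClosed (X.presheaf.stalk x)

/-! ### The absolute Frobenius -/

/-- The `p`-th power endomorphism of a commutative ring in which `p = 0`
(the zero ring is allowed). -/
def frobRingHom (p : ℕ) [hp : Fact p.Prime] (R : Type u) [CommRing R] (h : (p : R) = 0) :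
    R →+* R where
  toFun x := x ^ p
  map_one' := one_pow p
  map_mul' x y := mul_pow x y p
  map_zero' := zero_pow hp.out.ne_zero
  map_add' x y := by
    rcases subsingleton_or_nontrivial R with _ | _
    · exact Subsingleton.elim _ _
    · have : CharP R p := (CharP.charP_iff_prime_eq_zero hp.out).mpr h
      exact add_pow_char x y p

/-- `p = 0` in all rings of functions of `X`, i.e. `X` is a scheme over `𝔽_p`. -/
structure IsCharPScheme (p : ℕ) (X : Scheme.{u}) : Prop where
  natCast_eq_zero : ∀ U : X.Opens, (p : Γ(X, U)) = 0

/-- A scheme over a field of characteristic `p` is a scheme over `𝔽_p`. -/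
theorem isCharPScheme_of_hom (p : ℕ) {k : Type u} [Field k] [CharP k p] {X : Scheme.{u}}
    (f : X ⟶ Spec (.of k)) : IsCharPScheme p X where
  natCast_eq_zero U := by
    have h := map_natCast ((Scheme.ΓSpecIso (.of k)).inv ≫ f.appLE ⊤ U le_top).hom p
    rw [← h]
    have : ((p : ℕ) : (CommRingCat.of k)) = 0 := CharP.cast_eq_zero k p
    rw [this, map_zero]

/-- The morphism of presheaves of rings given by `s ↦ s ^ p` on all sections. -/
def frobPresheafHom (p : ℕ) [Fact p.Prime] (X : Scheme.{u}) (hX : IsCharPScheme p X) :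
    X.presheaf ⟶ X.presheaf where
  app U := CommRingCat.ofHom
    (frobRingHom p (X.presheaf.obj U) (hX.natCast_eq_zero U.unop))
  naturality U V i := by
    ext s
    exact (map_pow (X.presheaf.map i).hom s p).symm

/-- The absolute Frobenius `F_X : X ⟶ X` of a scheme over `𝔽_p`: the identity on the underlying
space, and `s ↦ s ^ p` on sections. -/
def absoluteFrobenius (p : ℕ) [hp : Fact p.Prime] (X : Scheme.{u}) (hX : IsCharPScheme p X) :
    X ⟶ X where
  base := 𝟙 _
  c := frobPresheafHom p X hX
  prop x := by
    refine ⟨fun a ha => ?_⟩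
    obtain ⟨U, hxU, s, rfl⟩ := X.presheaf.exists_germ_eq a
    have h := PresheafedSpace.stalkMap_germ_apply
      (X := X.toPresheafedSpace) (Y := X.toPresheafedSpace)
      { base := 𝟙 _, c := frobPresheafHom p X hX } U x hxU s
    have h2 : IsUnit (X.presheaf.germ U x hxU (s ^ p)) := by
      have h3 := ha
      erw [h] at h3
      exact h3
    rw [map_pow] at h2
    exact (isUnit_pow_iff hp.out.ne_zero).mp h2

theorem absoluteFrobenius_app_apply (p : ℕ) [Fact p.Prime] (X : Scheme.{u})
    (hX : IsCharPScheme p X) (U : X.Opens) (s : Γ(X, U)) :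
    (absoluteFrobenius p X hX).app U s = s ^ p := rfl

/-! ### Frobenius splittings -/

/-- The structure sheaf `𝒪_X`, as an `𝒪_X`-module. -/
abbrev structureModule (X : Scheme.{u}) : X.Modules :=
  SheafOfModules.unit X.ringCatSheaf

/-- The map `f^# : 𝒪_Y ⟶ f_* 𝒪_X` of `𝒪_Y`-modules attached to `f : X ⟶ Y`. -/
def structureMap {X Y : Scheme.{u}} (f : X ⟶ Y) :
    structureModule Y ⟶ (Scheme.Modules.pushforward f).obj (structureModule X) :=
  SheafOfModules.unitToPushforwardObjUnit f.toRingCatSheafHom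

/-- `X` is Frobenius split: it is a scheme over `𝔽_p` and there is a homomorphism of
`𝒪_X`-modules `φ : F_{X*} 𝒪_X ⟶ 𝒪_X` which splits `F_X^# : 𝒪_X ⟶ F_{X*} 𝒪_X`. -/
def IsFrobeniusSplit (p : ℕ) [Fact p.Prime] (X : Scheme.{u}) : Prop :=
  ∃ (hX : IsCharPScheme p X)
    (φ : (Scheme.Modules.pushforward (absoluteFrobenius p X hX)).obj (structureModule X) ⟶
      structureModule X),
    structureMap (absoluteFrobenius p X hX) ≫ φ = 𝟙 (structureModule X)

/-! ### Witt vectors of length two -/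

section Witt

variable (p : ℕ) [Fact p.Prime] (k : Type u) [Field k]

/-- The ring `W₂(k)` of `p`-typical Witt vectors of length two. -/
abbrev W2 : Type u := TruncatedWittVector p 2 k

/-- The reduction map `W₂(k) → k`, `(a₀, a₁) ↦ a₀`. -/
def W2.residue : W2 p k →+* k :=
  RingHom.liftOfRightInverse (WittVector.truncate 2) TruncatedWittVector.out
    TruncatedWittVector.truncateFun_out
    ⟨WittVector.constantCoeff, fun x hx => by
      rw [WittVector.mem_ker_truncate] at hx
      exact hx 0 two_pos⟩

theorem W2.residue_apply (a : W2 p k) : W2.residue p k a = a.coeff 0 := by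
  obtain ⟨x, rfl⟩ := WittVector.truncate_surjective p 2 k a
  exact (RingHom.liftOfRightInverse_comp_apply _ _ _ _ x).trans
    (WittVector.coeff_truncate (n := 2) x 0).symm

/-- The Frobenius `σ` of `W₂(k)`, `(a₀, a₁) ↦ (a₀ᵖ, a₁ᵖ)`. -/
def W2.frob [CharP k p] : W2 p k →+* W2 p k :=
  RingHom.liftOfRightInverse (WittVector.truncate 2) TruncatedWittVector.out
    TruncatedWittVector.truncateFun_out
    ⟨(WittVector.truncate 2).comp WittVector.frobenius, fun x hx => by
      rw [WittVector.mem_ker_truncate] at hx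
      rw [RingHom.mem_ker, RingHom.comp_apply, ← RingHom.mem_ker, WittVector.mem_ker_truncate]
      intro i hi
      rw [WittVector.coeff_frobenius_charP, hx i hi, zero_pow (Fact.out : p.Prime).ne_zero]⟩

theorem W2.coeff_frob [CharP k p] (a : W2 p k) (i : Fin 2) :
    (W2.frob p k a).coeff i = a.coeff i ^ p := by
  obtain ⟨x, rfl⟩ := WittVector.truncate_surjective p 2 k a
  have h : W2.frob p k (WittVector.truncate 2 x)
      = WittVector.truncate 2 (WittVector.frobenius x) :=
    RingHom.liftOfRightInverse_comp_apply _ _ _ _ x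
  rw [h, WittVector.coeff_truncate, WittVector.coeff_truncate, WittVector.coeff_frobenius_charP]

/-- The closed immersion `Spec k ⟶ Spec W₂(k)`. -/
def specResidue : Spec (.of k) ⟶ Spec (.of (W2 p k)) :=
  Spec.map (CommRingCat.ofHom (W2.residue p k))

/-- The morphism `Spec W₂(k) ⟶ Spec W₂(k)` induced by the Frobenius `σ`. -/
def specFrob [CharP k p] : Spec (.of (W2 p k)) ⟶ Spec (.of (W2 p k)) :=
  Spec.map (CommRingCat.ofHom (W2.frob p k))

end Witt

/-! ### Liftings -/

/-- A `W₂(k)`-lifting of a `k`-scheme `f : X ⟶ Spec k`: a flat morphism `X' ⟶ Spec W₂(k)` together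
with a morphism `i : X ⟶ X'` that identifies `X` with `X' ×_{Spec W₂(k)} Spec k` over `k`. -/
structure W2Lifting (p : ℕ) [Fact p.Prime] {k : Type u} [Field k] {X : Scheme.{u}}
    (f : X ⟶ Spec (.of k)) where
  total : Scheme.{u}
  toBase : total ⟶ Spec (.of (W2 p k))
  flat : Flat toBase
  incl : X ⟶ total
  isPullback : IsPullback incl f toBase (specResidue p k)

/-- A lifting of the Frobenius of `X` to a `W₂(k)`-lifting `X'` of `X`: an endomorphism of `X'`
lying over the Frobenius of `W₂(k)` and restricting to the absolute Frobenius on `X`. -/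
structure FrobeniusLifting {p : ℕ} [Fact p.Prime] {k : Type u} [Field k] [CharP k p]
    {X : Scheme.{u}} {f : X ⟶ Spec (.of k)} (L : W2Lifting p f) where
  hom : L.total ⟶ L.total
  over_frob : hom ≫ L.toBase = L.toBase ≫ specFrob p k
  restrict : L.incl ≫ hom = absoluteFrobenius p X (isCharPScheme_of_hom p f) ≫ L.incl

end FrobLift

end

/-! On an affine open with ring of functions `A`, the lifted Frobenius has the form `F a = a ^ p + p
* δ a`. Flatness makes `δ` well defined modulo `p`-th powers on `A`, so `da ↦ a ^ (p - 1) da +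
dδ(a)` is a Frobenius-linear map on one-forms, the differential of `F` divided by `p`. Let `K` be
the fraction field of a domain `A`; since `k` is perfect and `A` of finite type, `K` has a finite
`p`-basis `x`. The top exterior power of this map sends `ω = dlog x₁ ∧ ⋯ ∧ dlog xₙ` to `Δ ω`, where
`Δ` is `frobDet`. The splitting is `g ↦ C(g Δ ω) / ω`, with `C` the Cartier operator; in logarithmic
coordinates `C` reads off the coefficient of the monomial of degree zero (`fieldSplit`).

It maps 1 to 1 because `Δ ω` is `ω` plus wedge products with an exact factor, which `C` kills
(`proj_zero_det_one_add`). It does not depend on the `p`-basis, because the kernel of `C` is the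
group of exact forms and `Δ` transforms by Jacobians (`frobDet_eq_mul`, `fieldSplit_eq`).

It preserves a normal `A` because `A` is the intersection of its localizations at primes that become
principal. In such a discrete valuation ring a uniformizer and lifts of a `p`-basis of the residue
field form a `p`-basis of the ring itself (`isPBasis_cons`); computing with `dxᵢ` in place of `dlog
xᵢ` then removes all denominators (`fieldSplit_mem`).

Being canonical, these splittings commute with restriction (`IsSplit.comp_eq`), and they glue from a
basis of affine opens whose rings are domains. -/

noncomputable section

namespace FrobLift

set_option linter.unusedSectionVars false

/-! ### `p`-bases of fields -/

section PBasis

variable (p : ℕ) [hp : Fact p.Prime] {ι : Type*} [Fintype ι] [DecidableEq ι]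

/-- The monomial `∏ xᵢ ^ eᵢ`, with exponents `0 ≤ eᵢ < p`. -/
def pmon {R : Type*} [CommRing R] (x : ι → R) (e : ι → ZMod p) : R := ∏ i, x i ^ (e i).val

/-- `x` is a `p`-basis: every element is uniquely a sum of `p`-th powers times monomials in `x`
with exponents less than `p`. -/
def IsPBasis {R : Type*} [CommRing R] (x : ι → R) : Prop :=
  Function.Bijective (fun c : (ι → ZMod p) → R => ∑ e, c e ^ p * pmon p x e)

/-- `a` is a `p`-th power times the monomial with exponent `e`. -/
def IsHomog {R : Type*} [CommRing R] (x : ι → R) (e : ι → ZMod p) (a : R) : Prop :=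
  ∃ c, a = c ^ p * pmon p x e

variable {p}

section Ring

variable {R : Type*} [CommRing R] {x : ι → R}

theorem pmon_zero : pmon p x 0 = 1 := by simp [pmon]

theorem pmon_single (i : ι) : pmon p x (Pi.single i 1) = x i := by
  have : Fact (1 < p) := ⟨hp.out.one_lt⟩
  rw [pmon, Finset.prod_eq_single i]
  · simp [ZMod.val_one]
  · intro j _ hj
    simp [Pi.single_eq_of_ne hj]
  · simp

theorem isHomog_zero (e : ι → ZMod p) : IsHomog p x e 0 :=
  ⟨0, by simp [hp.out.ne_zero]⟩

theorem isHomog_pow (c : R) : IsHomog p x 0 (c ^ p) := ⟨c, by simp [pmon_zero]⟩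

theorem isHomog_one : IsHomog p x 0 1 := ⟨1, by simp [pmon_zero]⟩

theorem isHomog_self (i : ι) : IsHomog p x (Pi.single i 1) (x i) :=
  ⟨1, by simp [pmon_single]⟩

/-- Exponents add with carry: the quotient by `p` moves into the `p`-th power, the remainder is the
sum in `ZMod p`. So a `p`-basis grades the ring by `ι → ZMod p`. -/
theorem IsHomog.mul {e f : ι → ZMod p} {a b : R} (ha : IsHomog p x e a) (hb : IsHomog p x f b) :
    IsHomog p x (e + f) (a * b) := by
  obtain ⟨c, rfl⟩ := ha
  obtain ⟨d, rfl⟩ := hb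
  refine ⟨c * d * ∏ i, x i ^ (((e i).val + (f i).val) / p), ?_⟩
  have : pmon p x e * pmon p x f
      = (∏ i, x i ^ (((e i).val + (f i).val) / p)) ^ p * pmon p x (e + f) := by
    simp only [pmon, ← Finset.prod_mul_distrib, ← Finset.prod_pow]
    refine Finset.prod_congr rfl fun i _ => ?_
    rw [← pow_add, ← pow_mul, ← pow_add, Pi.add_apply, ZMod.val_add, Nat.div_add_mod']
  rw [mul_pow, mul_pow]
  linear_combination c ^ p * d ^ p * this

theorem IsHomog.prod {κ : Type*} (s : Finset κ) {e : κ → ι → ZMod p} {a : κ → R}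
    (h : ∀ k ∈ s, IsHomog p x (e k) (a k)) : IsHomog p x (∑ k ∈ s, e k) (∏ k ∈ s, a k) := by
  classical
  induction s using Finset.induction_on with
  | empty => simpa using isHomog_one
  | insert k s hk ih =>
    rw [Finset.sum_insert hk, Finset.prod_insert hk]
    exact (h k (Finset.mem_insert_self _ _)).mul
      (ih fun j hj => h j (Finset.mem_insert_of_mem hj))

end Ring

variable {K : Type*} [Field K] [CharP K p] {x : ι → K}

/-- The embedding of the prime field. -/
def primeCast (p : ℕ) [Fact p.Prime] (K : Type*) [Field K] [CharP K p] : ZMod p →+* K :=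
  ZMod.castHom (dvd_refl p) K

theorem isHomog_primeCast_mul {e : ι → ZMod p} {a : K} (z : ZMod p) (ha : IsHomog p x e a) :
    IsHomog p x e (primeCast p K z * a) := by
  obtain ⟨c, rfl⟩ := ha
  refine ⟨primeCast p K z * c, ?_⟩
  rw [mul_pow, ← map_pow, ZMod.pow_card, mul_assoc]

namespace IsPBasis

variable (hx : IsPBasis p x)

/-- The coefficients of an element with respect to a `p`-basis. -/
def repr (a : K) : (ι → ZMod p) → K := (Equiv.ofBijective _ hx).symm a

theorem sum_repr (a : K) : ∑ e, hx.repr a e ^ p * pmon p x e = a :=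
  (Equiv.ofBijective _ hx).apply_symm_apply a

theorem repr_eq {a : K} {c : (ι → ZMod p) → K} (h : ∑ e, c e ^ p * pmon p x e = a) :
    hx.repr a = c := by
  subst h
  exact (Equiv.ofBijective _ hx).symm_apply_apply c

theorem repr_add (a b : K) : hx.repr (a + b) = hx.repr a + hx.repr b := by
  apply hx.repr_eq
  conv_rhs => rw [← hx.sum_repr a, ← hx.sum_repr b, ← Finset.sum_add_distrib]
  simp only [Pi.add_apply, add_pow_char, add_mul]

theorem repr_pow_mul (b a : K) : hx.repr (b ^ p * a) = b • hx.repr a := by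
  apply hx.repr_eq
  conv_rhs => rw [← hx.sum_repr a, Finset.mul_sum]
  simp only [Pi.smul_apply, smul_eq_mul, mul_pow, mul_assoc]

theorem repr_zero : hx.repr 0 = 0 := hx.repr_eq (by simp [hp.out.ne_zero])

/-- The coefficients of the monomial `x ^ e`, as an additive map. -/
def coeff (e : ι → ZMod p) : K →+ K where
  toFun a := hx.repr a e
  map_zero' := by rw [hx.repr_zero]; rfl
  map_add' a b := by rw [hx.repr_add]; rfl

/-- The projection to the component of degree `e`. -/
def proj (e : ι → ZMod p) : K →+ K where
  toFun a := hx.coeff e a ^ p * pmon p x e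
  map_zero' := by simp [hp.out.ne_zero]
  map_add' a b := by rw [map_add, add_pow_char, add_mul]

theorem proj_apply (e : ι → ZMod p) (a : K) :
    hx.proj e a = hx.coeff e a ^ p * pmon p x e := rfl

theorem sum_proj (a : K) : ∑ e, hx.proj e a = a := hx.sum_repr a

theorem isHomog_proj (e : ι → ZMod p) (a : K) : IsHomog p x e (hx.proj e a) :=
  ⟨_, hx.proj_apply e a⟩

theorem coeff_pow_mul (e : ι → ZMod p) (b a : K) : hx.coeff e (b ^ p * a) = b * hx.coeff e a := by
  change hx.repr _ e = _
  rw [hx.repr_pow_mul]; rfl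

theorem coeff_mul_pmon (e f : ι → ZMod p) (c : K) :
    hx.coeff f (c ^ p * pmon p x e) = if f = e then c else 0 := by
  change hx.repr _ f = _
  rw [hx.repr_eq (c := Pi.single e c)]
  · rw [Pi.single_apply]
  · rw [Finset.sum_eq_single e]
    · simp
    · intro g _ hg
      simp [Pi.single_eq_of_ne hg, hp.out.ne_zero]
    · simp

theorem proj_eq_of_isHomog {e : ι → ZMod p} {a : K} (ha : IsHomog p x e a)
    (f : ι → ZMod p) : hx.proj f a = if f = e then a else 0 := by
  obtain ⟨c, rfl⟩ := ha
  rw [proj_apply, coeff_mul_pmon]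
  split_ifs with h
  · rw [h]
  · simp [hp.out.ne_zero]

include hx in
theorem ne_zero (i : ι) : x i ≠ 0 := by
  classical
  intro h
  have h1 := hx.coeff_mul_pmon (Pi.single i 1) (Pi.single i 1) 1
  rw [pmon_single, h, mul_zero, map_zero, if_pos rfl] at h1
  exact zero_ne_one h1

theorem sum_coe_mul_proj_of_isHomog (j : ι) {e : ι → ZMod p} {a : K} (ha : IsHomog p x e a) :
    ∑ f, primeCast p K (f j) * hx.proj f a = primeCast p K (e j) * a := by
  classical
  rw [Finset.sum_eq_single e]
  · rw [hx.proj_eq_of_isHomog ha, if_pos rfl]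
  · intro f _ hf
    rw [hx.proj_eq_of_isHomog ha, if_neg hf, mul_zero]
  · simp

/-- The logarithmic derivation `xⱼ ∂/∂xⱼ`. -/
def theta (j : ι) : Derivation ℤ K K :=
  Derivation.mk'
    (AddMonoidHom.toIntLinearMap
      { toFun := fun a => ∑ e, primeCast p K (e j) * hx.proj e a
        map_zero' := by simp
        map_add' := fun a b => by simp [mul_add, Finset.sum_add_distrib] })
    (by
      intro a b
      let T : K →+ K :=
        { toFun := fun a => ∑ e, primeCast p K (e j) * hx.proj e a
          map_zero' := by simp
          map_add' := fun a b => by simp [mul_add, Finset.sum_add_distrib] }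
      have hT : ∀ {e : ι → ZMod p} {a : K}, IsHomog p x e a → T a = primeCast p K (e j) * a :=
        fun ha => hx.sum_coe_mul_proj_of_isHomog j ha
      change T (a * b) = a * T b + b * T a
      -- On a product of homogeneous elements of degrees `e` and `f`, the Leibniz rule is the
      -- additivity of the weight `e ↦ e j`; the general case follows by expanding both factors.
      conv_lhs => rw [← hx.sum_proj a, ← hx.sum_proj b, Finset.sum_mul_sum]
      conv_rhs => rw [← hx.sum_proj a, ← hx.sum_proj b]
      simp only [map_sum, hT (hx.isHomog_proj _ _), Finset.mul_sum, Finset.sum_mul,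
        hT ((hx.isHomog_proj _ _).mul (hx.isHomog_proj _ _))]
      rw [Finset.sum_comm (f := fun i k => hx.proj k a * (primeCast p K (i j) * hx.proj i b)),
        ← Finset.sum_add_distrib]
      refine Finset.sum_congr rfl fun e _ => ?_
      rw [← Finset.sum_add_distrib]
      refine Finset.sum_congr rfl fun f _ => ?_
      rw [Pi.add_apply, map_add]
      ring)

theorem theta_apply (j : ι) (a : K) :
    hx.theta j a = ∑ e, primeCast p K (e j) * hx.proj e a := rfl

theorem theta_of_isHomog (j : ι) {e : ι → ZMod p} {a : K} (ha : IsHomog p x e a) :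
    hx.theta j a = primeCast p K (e j) * a :=
  hx.sum_coe_mul_proj_of_isHomog j ha

theorem theta_self (i j : ι) : hx.theta j (x i) = if i = j then x i else 0 := by
  rw [hx.theta_of_isHomog j (isHomog_self i), Pi.single_apply]
  split_ifs <;> simp_all

end IsPBasis

theorem derivation_pow_char {M : Type*} [AddCommGroup M] [Module K M] (D : Derivation ℤ K M)
    (a : K) : D (a ^ p) = 0 := by
  rw [D.leibniz_pow, ← Nat.cast_smul_eq_nsmul K, CharP.cast_eq_zero, zero_smul]

end PBasis

/-! ### Derivations, exact top forms and change of `p`-basis -/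

section
variable {p : ℕ} [hp : Fact p.Prime] {ι : Type*} [Fintype ι] [DecidableEq ι]
  {K : Type*} [Field K] [CharP K p] {x : ι → K}

theorem derivation_sum_apply {κ : Type*} (s : Finset κ) (D : κ → Derivation ℤ K K) (a : K) :
    (∑ i ∈ s, D i) a = ∑ i ∈ s, D i a := by
  have := map_sum Derivation.coeFnAddMonoidHom D s
  exact (congrFun this a).trans (Finset.sum_apply _ _ _)

namespace IsPBasis

variable (hx : IsPBasis p x)

include hx in
theorem derivation_eq_zero {E : Derivation ℤ K K} (hE : ∀ i, E (x i) = 0) (a : K) : E a = 0 := by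
  have hmon (e : ι → ZMod p) : E (pmon p x e) = 0 := by
    refine Finset.prod_induction _ (fun b => E b = 0) (fun a b ha hb => ?_) E.map_one_eq_zero
      fun i _ => ?_
    · rw [E.leibniz, ha, hb, smul_zero, smul_zero, add_zero]
    · rw [E.leibniz_pow, hE, smul_zero, smul_zero]
  rw [← hx.sum_repr a, map_sum]
  refine Finset.sum_eq_zero fun e _ => ?_
  rw [E.leibniz, hmon, derivation_pow_char, smul_zero, smul_zero, add_zero]

theorem derivation_eq (D : Derivation ℤ K K) :
    D = ∑ i, (D (x i) / x i) • hx.theta i := by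
  rw [← sub_eq_zero]
  ext a
  refine hx.derivation_eq_zero (fun i => ?_) a
  rw [Derivation.sub_apply, derivation_sum_apply, Finset.sum_eq_single i]
  · simp [theta_self, hx.ne_zero i]
  · intro j _ hj
    simp [theta_self, hj.symm]
  · simp

theorem derivation_apply (D : Derivation ℤ K K) (a : K) :
    D a = ∑ i, D (x i) / x i * hx.theta i a := by
  conv_lhs => rw [hx.derivation_eq D]
  simp [derivation_sum_apply]

/-- The degree zero part of a wedge product of exact one-forms and of logarithmic forms `dxᵢ/xᵢ`
vanishes as soon as there is at least one exact factor. -/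
theorem proj_zero_det {S : Finset ι} (hS : S.Nonempty) (a : ι → K) :
    hx.proj 0 (Matrix.det (Matrix.of fun i j =>
      if i ∈ S then hx.theta j (a i) else (1 : Matrix ι ι K) i j)) = 0 := by
  -- Component of degree `e` of row `i`; the rows outside `S`, being those of `dlog xᵢ`, lie in
  -- degree zero.
  let v (i : ι) (e : ι → ZMod p) (j : ι) : K :=
    if i ∈ S then primeCast p K (e j) * hx.proj e (a i)
    else if e = 0 then (1 : Matrix ι ι K) i j else 0
  have hrow : (Matrix.of fun i j => if i ∈ S then hx.theta j (a i) else (1 : Matrix ι ι K) i j)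
      = Matrix.of fun i => ∑ e, v i e := by
    funext i j
    rw [Matrix.of_apply, Matrix.of_apply, Finset.sum_apply]
    by_cases hi : i ∈ S
    · simp only [v, if_pos hi, theta_apply]
    · simp [v, if_neg hi]
  rw [hrow]
  have hexp := (Matrix.detRowAlternating (n := ι) (R := K)).toMultilinearMap.map_sum v
  change Matrix.det (Matrix.of fun i => ∑ e, v i e)
    = ∑ r : ι → ι → ZMod p, Matrix.det (Matrix.of fun i => v i (r i)) at hexp
  rw [hexp, map_sum]
  refine Finset.sum_eq_zero fun r _ => ?_
  by_cases hr : ∃ i, i ∉ S ∧ r i ≠ 0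
  · obtain ⟨i, hi, hri⟩ := hr
    rw [Matrix.det_eq_zero_of_row_eq_zero i, map_zero]
    intro j
    simp [v, hi, hri]
  push Not at hr
  -- Row `i` is now a scalar `w i` of degree `r i` times a row `m i` over the prime field, so the
  -- determinant is homogeneous of degree `∑ i, r i`.
  let w (i : ι) : K := if i ∈ S then hx.proj (r i) (a i) else 1
  let m : Matrix ι ι (ZMod p) := fun i => if i ∈ S then r i else Pi.single i 1
  have hdet : Matrix.det (Matrix.of fun i => v i (r i)) = primeCast p K m.det * ∏ i, w i := by
    have : (Matrix.of fun i => v i (r i)) = Matrix.of fun i j => w i * (primeCast p K).mapMatrix m i j := by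
      funext i j
      rw [Matrix.of_apply, Matrix.of_apply, RingHom.mapMatrix_apply, Matrix.map_apply]
      by_cases hi : i ∈ S
      · simp only [v, w, m, if_pos hi, mul_comm]
      · simp only [v, w, m, if_neg hi, if_pos (hr i hi), one_mul]
        by_cases hij : i = j
        · subst hij; simp
        · simp [hij, Ne.symm hij]
    rw [this, Matrix.det_mul_column, ← RingHom.map_det, mul_comm]
  have hw : IsHomog p x (∑ i, r i) (∏ i, w i) := by
    refine IsHomog.prod _ fun i _ => ?_
    by_cases hi : i ∈ S
    · simp only [w, if_pos hi]
      exact hx.isHomog_proj _ _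
    · simp only [w, if_neg hi, hr i hi]
      exact isHomog_one
  rw [hdet, hx.proj_eq_of_isHomog (isHomog_primeCast_mul _ hw)]
  split_ifs with h0
  -- In total degree zero the rows of `m` indexed by `S` are the degrees themselves and sum to zero.
  -- As `S` is nonempty, this is a linear dependence.
  · have : m.det = 0 := by
      rw [← Matrix.exists_vecMul_eq_zero_iff]
      refine ⟨fun i => if i ∈ S then 1 else 0, fun h => ?_, ?_⟩
      · obtain ⟨i, hi⟩ := hS
        simpa [hi] using congrFun h i
      · funext j
        have h1 := congrFun h0 j
        rw [Pi.zero_apply, Finset.sum_apply] at h1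
        refine Eq.trans ?_ h1.symm
        rw [Matrix.vecMul, dotProduct]
        refine Finset.sum_congr rfl fun i _ => ?_
        by_cases hi : i ∈ S
        · simp [m, hi]
        · simp [hi, hr i hi]
    rw [this, map_zero, zero_mul]
  · rfl

/-- Expand by rows: the term of a nonempty subset has an exact factor and no part of degree zero,
and the empty subset contributes `det 1 = 1`. This is why the splitting maps 1 to 1. -/
theorem proj_zero_det_one_add (a : ι → K) :
    hx.proj 0 (Matrix.det (1 + Matrix.of fun i j => hx.theta j (a i))) = 1 := by
  have hexp := (Matrix.detRowAlternating (n := ι) (R := K)).toMultilinearMap.map_add_univ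
    (Matrix.of fun i j => hx.theta j (a i)) (1 : Matrix ι ι K)
  change Matrix.det ((Matrix.of fun i j => hx.theta j (a i)) + (1 : Matrix ι ι K))
    = ∑ S : Finset ι, Matrix.det
      (S.piecewise (Matrix.of fun i j => hx.theta j (a i)) (1 : Matrix ι ι K))
    at hexp
  rw [add_comm]
  refine (congrArg _ hexp).trans ?_
  rw [map_sum, Finset.sum_eq_single ∅]
  · have h0 : (∅ : Finset ι).piecewise (Matrix.of fun i j => hx.theta j (a i))
        (1 : Matrix ι ι K) = (1 : Matrix ι ι K) := by
      funext i j
      simp [Finset.piecewise]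
    refine (congrArg (fun M : Matrix ι ι K => hx.proj 0 M.det) h0).trans ?_
    rw [Matrix.det_one, hx.proj_eq_of_isHomog isHomog_one, if_pos rfl]
  · intro S _ hS
    rw [← hx.proj_zero_det (Finset.nonempty_iff_ne_empty.mpr hS) a]
    congr 2
    funext i j
    by_cases hi : i ∈ S <;> simp [Finset.piecewise, hi]
  · simp

/-- Elements without degree zero part are, up to the factor `dx₁/x₁ ∧ ⋯ ∧ dxₙ/xₙ`, sums of
exact forms `da₁ ∧ ⋯ ∧ daₙ`. -/
theorem mem_closure_of_proj_zero {a : K} (ha : hx.proj 0 a = 0) :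
    a ∈ AddSubgroup.closure
      (Set.range fun b : ι → K => Matrix.det (Matrix.of fun i j => hx.theta j (b i))) := by
  rw [← hx.sum_proj a]
  refine AddSubgroup.sum_mem _ fun e _ => ?_
  by_cases he : e = 0
  · rw [he, ha]; exact zero_mem _
  obtain ⟨j, hj⟩ := Function.ne_iff.mp he
  rw [Pi.zero_apply] at hj
  let q : K := ∏ i ∈ Finset.univ.erase j, x i
  have hq0 : q ≠ 0 := Finset.prod_ne_zero_iff.mpr fun i _ => hx.ne_zero i
  have hq : hx.theta j q = 0 := by
    refine Finset.prod_induction _ (fun b => hx.theta j b = 0) (fun a b ha hb => ?_)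
      (hx.theta j).map_one_eq_zero fun i hi => ?_
    · rw [Derivation.leibniz, ha, hb, smul_zero, smul_zero, add_zero]
    · rw [theta_self, if_neg (Finset.ne_of_mem_erase hi)]
  -- Integration in direction `j`: `θⱼ` multiplies degree `e` by `e j ≠ 0`, and `q` is a constant
  -- for `θⱼ` that will cancel the diagonal entries `x i`, `i ≠ j`.
  let b : ι → K := Function.update x j (primeCast p K (e j)⁻¹ * hx.proj e a * q⁻¹)
  have hb : hx.theta j (b j) = hx.proj e a * q⁻¹ := by
    simp only [b, Function.update_self]
    rw [Derivation.leibniz, Derivation.leibniz_inv, hq, smul_zero, smul_zero, zero_add,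
      hx.theta_of_isHomog j (isHomog_primeCast_mul _ (hx.isHomog_proj e a)), ← mul_assoc,
      ← map_mul, mul_inv_cancel₀ hj, map_one, one_mul, smul_eq_mul, mul_comm]
  refine AddSubgroup.subset_closure ⟨b, ?_⟩
  have hM : (Matrix.of fun i l => hx.theta l (b i)) = (Matrix.diagonal x).updateRow j
      (∑ k, (hx.theta k (b j) / x k) • (Matrix.diagonal x) k) := by
    ext i l
    rw [Matrix.of_apply, Matrix.updateRow_apply]
    split_ifs with hi
    · subst hi
      rw [Finset.sum_apply, Finset.sum_eq_single l]
      · simp [hx.ne_zero l]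
      · intro k _ hk
        simp [hk]
      · simp
    · simp only [b, Function.update_of_ne hi, theta_self, Matrix.diagonal_apply]
  change Matrix.det (Matrix.of fun i l => hx.theta l (b i)) = _
  rw [hM, Matrix.det_updateRow_sum, Matrix.det_diagonal, hb, smul_eq_mul,
    ← Finset.mul_prod_erase _ _ (Finset.mem_univ j)]
  change hx.proj e a * q⁻¹ / x j * (x j * q) = _
  have := hx.ne_zero j
  field_simp

theorem coeff_zero_eq_zero_iff {a : K} : hx.coeff 0 a = 0 ↔ hx.proj 0 a = 0 := by
  rw [proj_apply, pmon_zero, mul_one, pow_eq_zero_iff hp.out.ne_zero]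

theorem theta_eq {y : ι → K} (hy : IsPBasis p y) (b : ι → K) :
    (Matrix.of fun i j => hy.theta j (b i))
      = (Matrix.of fun i j => hx.theta j (b i))
        * Matrix.of fun i j => hy.theta j (x i) / x i := by
  ext i j
  rw [Matrix.mul_apply, Matrix.of_apply, hx.derivation_apply]
  exact Finset.sum_congr rfl fun l _ => mul_comm _ _

/-- The kernel of the Cartier operator is intrinsic: it consists of the sums of forms `da₁ ∧ ⋯ ∧
daₙ`, and passing from the coordinates `x` to `y` multiplies the coefficient of such a form by the
Jacobian. -/
theorem coeff_zero_mul_det {y : ι → K} (hy : IsPBasis p y) {a : K} (ha : hx.coeff 0 a = 0) :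
    hy.coeff 0 (a * Matrix.det (Matrix.of fun i j => hy.theta j (x i) / x i)) = 0 := by
  rw [coeff_zero_eq_zero_iff] at ha ⊢
  -- Without variables the empty wedge is not exact, but then degree zero is everything and `a = 0`.
  rcases isEmpty_or_nonempty ι with _ | _
  · have h0 : a = 0 := by
      rw [← hx.sum_proj a]
      exact Finset.sum_eq_zero fun e _ => Subsingleton.elim 0 e ▸ ha
    rw [h0, zero_mul, map_zero]
  · have hmem := hx.mem_closure_of_proj_zero ha
    clear ha
    induction hmem using AddSubgroup.closure_induction with
    | mem a ha =>
      obtain ⟨b, rfl⟩ := ha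
      dsimp only
      rw [← Matrix.det_mul, ← hx.theta_eq hy]
      simpa using hy.proj_zero_det Finset.univ_nonempty b
    | zero => simp
    | add a b _ _ ha hb => rw [add_mul, map_add, ha, hb, add_zero]
    | neg a _ ha => rw [neg_mul, map_neg, ha, neg_zero]

include hx in
-- The logarithmic derivations of either `p`-basis are a basis of all derivations, so the two
-- transition matrices are mutually inverse, hence square.
theorem card_eq {κ : Type*} [Fintype κ] [DecidableEq κ] {y : κ → K} (hy : IsPBasis p y) :
    Fintype.card ι = Fintype.card κ := by
  let P : Matrix ι κ K := fun i j => hx.theta i (y j) / y j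
  let Q : Matrix κ ι K := fun j i => hy.theta j (x i) / x i
  refine Matrix.square_of_invertible P Q ?_ ?_
  all_goals
    ext i j
    rw [Matrix.mul_apply, Matrix.one_apply]
  · have := hy.derivation_apply (hx.theta i) (x j)
    rw [theta_self] at this
    simp only [P, Q, mul_div_assoc', ← Finset.sum_div, ← this]
    rcases eq_or_ne i j with rfl | h
    · simp [hx.ne_zero i]
    · simp [h, h.symm]
  · have := hx.derivation_apply (hy.theta i) (y j)
    rw [theta_self] at this
    simp only [P, Q, mul_div_assoc', ← Finset.sum_div, ← this]
    rcases eq_or_ne i j with rfl | h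
    · simp [hy.ne_zero i]
    · simp [h, h.symm]

end IsPBasis
end

section
variable {p : ℕ} [hp : Fact p.Prime] {A : Type*} [CommRing A] {K : Type*} [Field K] [CharP K p]
  [Algebra A K]

/-! ### Frobenius derivations -/

/-- The map `a ↦ aᵖ⁻¹ D a + D (s a)`. If `a ↦ aᵖ + p s(a)` comes from a lifting of Frobenius,
this is the contraction of `D` with the differential of the lifting divided by `p`. -/
def frobDer (p : ℕ) (s : A → K) (D : Derivation ℤ K K) (a : A) : K :=
  algebraMap A K a ^ (p - 1) * D (algebraMap A K a) + D (s a)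

/-- `s` behaves like `a ↦ (F a - a ^ p) / p` for a lifting of Frobenius `F`. -/
structure IsFrobDelta (p : ℕ) (s : A → K) : Prop where
  frobDer_add : ∀ (D : Derivation ℤ K K) (a b : A),
    frobDer p s D (a + b) = frobDer p s D a + frobDer p s D b
  frobDer_mul : ∀ (D : Derivation ℤ K K) (a b : A),
    frobDer p s D (a * b)
      = algebraMap A K a ^ p * frobDer p s D b + algebraMap A K b ^ p * frobDer p s D a

section FrobLeibniz

variable {E : A → K}
  (hmul : ∀ a b, E (a * b) = algebraMap A K a ^ p * E b + algebraMap A K b ^ p * E a)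

include hmul in
theorem frobLeibniz_one : E 1 = 0 := by
  have := hmul 1 1
  rw [map_one, one_pow, one_mul] at this
  simpa using this

include hmul in
theorem frobLeibniz_pow_succ (a : A) (n : ℕ) :
    E (a ^ (n + 1)) = (n + 1) * algebraMap A K a ^ (p * n) * E a := by
  induction n with
  | zero => simp
  | succ n ih =>
    rw [pow_succ, hmul, ih, map_pow]
    push_cast
    ring

include hmul in
theorem frobLeibniz_pow_char (a : A) : E (a ^ p) = 0 := by
  obtain ⟨n, hn⟩ := Nat.exists_eq_succ_of_ne_zero hp.out.ne_zero
  have h := frobLeibniz_pow_succ hmul a n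
  rw [← Nat.cast_succ, ← Nat.succ_eq_add_one, ← hn, CharP.cast_eq_zero, zero_mul, zero_mul] at h
  exact h

variable {ι : Type*} [Fintype ι] [DecidableEq ι] {x : ι → A}

include hmul in
-- `E` is a derivation into `K` with `A` acting through Frobenius, so it kills `p`-th powers and is
-- determined by its values on a `p`-basis.
theorem frobLeibniz_eq_zero [IsFractionRing A K] (hadd : ∀ a b, E (a + b) = E a + E b)
    (hx : IsPBasis p (fun i => algebraMap A K (x i))) (hE : ∀ i, E (x i) = 0) (a : A) :
    E a = 0 := by
  have hmon (e : ι → ZMod p) : E (pmon p x e) = 0 := by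
    refine Finset.prod_induction _ (fun b => E b = 0) (fun a b ha hb => ?_)
      (frobLeibniz_one hmul) fun i _ => ?_
    · rw [hmul, ha, hb, mul_zero, mul_zero, add_zero]
    · rcases Nat.eq_zero_or_eq_succ_pred (e i).val with h | h
      · rw [h, pow_zero, frobLeibniz_one hmul]
      · rw [h, Nat.succ_eq_add_one, frobLeibniz_pow_succ hmul, hE, mul_zero]
  obtain ⟨b, hb⟩ := IsLocalization.exist_integer_multiples (nonZeroDivisors A) Finset.univ
    (hx.repr (algebraMap A K a))
  choose c hc using fun e => hb e (Finset.mem_univ e)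
  have hb0 : algebraMap A K b ≠ 0 := (IsLocalization.map_units K b).ne_zero
  -- `E` is defined on `A` only, so a common denominator of the coefficients is cleared; this
  -- multiplies `E a` by a nonzero power of `b`.
  have key : (b : A) ^ p * a = ∑ e, c e ^ p * pmon p x e := by
    apply IsFractionRing.injective A K
    rw [map_mul, map_sum]
    conv_lhs => rw [← hx.sum_repr (algebraMap A K a), Finset.mul_sum]
    refine Finset.sum_congr rfl fun e _ => ?_
    rw [map_mul, map_pow, map_pow, hc, Algebra.smul_def, mul_pow, mul_assoc]
    simp [pmon]
  have hz : E ((b : A) ^ p * a) = 0 := by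
    let E' : A →+ K := AddMonoidHom.mk' E hadd
    change E' _ = 0
    rw [key, map_sum]
    refine Finset.sum_eq_zero fun e _ => ?_
    change E _ = 0
    rw [hmul, hmon, frobLeibniz_pow_char hmul, mul_zero, mul_zero, add_zero]
  rw [hmul, frobLeibniz_pow_char hmul, mul_zero, add_zero] at hz
  exact (mul_eq_zero.mp hz).resolve_left (by simp [hb0])

end FrobLeibniz

variable {ι : Type*} [Fintype ι] [DecidableEq ι] {x : ι → A}

/-- Chain rule for the divided differential: both sides are additive, obey the Frobenius-twisted
Leibniz rule and agree on the `p`-basis. -/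
theorem IsFrobDelta.frobDer_eq [IsFractionRing A K] {s : A → K} (hs : IsFrobDelta p s)
    (hx : IsPBasis p (fun i => algebraMap A K (x i))) (D : Derivation ℤ K K) (a : A) :
    frobDer p s D a
      = ∑ i, frobDer p s D (x i) / algebraMap A K (x i) ^ p
        * hx.theta i (algebraMap A K a) ^ p := by
  rw [← sub_eq_zero]
  refine frobLeibniz_eq_zero (p := p) (E := fun a => frobDer p s D a - ∑ i,
    frobDer p s D (x i) / algebraMap A K (x i) ^ p * hx.theta i (algebraMap A K a) ^ p)
    (fun a b => ?_) (fun a b => ?_) hx (fun i => ?_) a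
  · simp only [hs.frobDer_mul, map_mul, Derivation.leibniz, smul_eq_mul, add_pow_char, mul_pow,
      mul_add, Finset.sum_add_distrib, mul_sub, Finset.mul_sum]
    have h (a b : A) : ∑ i, frobDer p s D (x i) / algebraMap A K (x i) ^ p *
          (algebraMap A K a ^ p * hx.theta i (algebraMap A K b) ^ p)
        = ∑ i, algebraMap A K a ^ p * (frobDer p s D (x i) / algebraMap A K (x i) ^ p *
          hx.theta i (algebraMap A K b) ^ p) :=
      Finset.sum_congr rfl fun i _ => by ring
    rw [h, h]
    ring
  · simp only [hs.frobDer_add, map_add, add_pow_char, mul_add, Finset.sum_add_distrib]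
    ring
  · rw [Finset.sum_eq_single i]
    · have := hx.ne_zero i
      rw [hx.theta_self, if_pos rfl, div_mul_cancel₀ _ (pow_ne_zero _ this), sub_self]
    · intro j _ hj
      rw [hx.theta_self, if_neg hj.symm, zero_pow hp.out.ne_zero, mul_zero]
    · simp

theorem frobDer_eq_sum {x : ι → K} (hx : IsPBasis p x) (s : A → K) (D : Derivation ℤ K K)
    (a : A) : frobDer p s D a = ∑ i, D (x i) / x i * frobDer p s (hx.theta i) a := by
  simp only [frobDer, mul_add, Finset.sum_add_distrib]
  rw [← hx.derivation_apply D (s a), hx.derivation_apply D (algebraMap A K a), Finset.mul_sum]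
  congr 1
  exact Finset.sum_congr rfl fun i _ => by ring

/-! ### The splitting of the function field -/

/-- The determinant of the lifting of Frobenius with respect to logarithmic coordinates. -/
def frobDet (s : A → K) (hx : IsPBasis p (fun i => algebraMap A K (x i))) : K :=
  Matrix.det (1 + Matrix.of fun i j => hx.theta j (s (x i) / algebraMap A K (x i) ^ p))

/-- The Frobenius splitting of the field `K` attached to a lifting of Frobenius. -/
def fieldSplit (s : A → K) (hx : IsPBasis p (fun i => algebraMap A K (x i))) : K →+ K :=
  (hx.coeff 0).comp (AddMonoidHom.mulRight (frobDet s hx))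

theorem fieldSplit_apply (s : A → K) (hx : IsPBasis p (fun i => algebraMap A K (x i))) (g : K) :
    fieldSplit s hx g = hx.coeff 0 (g * frobDet s hx) := rfl

theorem fieldSplit_pow_mul (s : A → K) (hx : IsPBasis p (fun i => algebraMap A K (x i)))
    (b g : K) : fieldSplit s hx (b ^ p * g) = b * fieldSplit s hx g := by
  rw [fieldSplit_apply, mul_assoc, hx.coeff_pow_mul, fieldSplit_apply]

theorem fieldSplit_one (s : A → K) (hx : IsPBasis p (fun i => algebraMap A K (x i))) :
    fieldSplit s hx 1 = 1 := by
  have h := hx.proj_zero_det_one_add fun i => s (x i) / algebraMap A K (x i) ^ p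
  rw [hx.proj_apply, pmon_zero, mul_one, ← frobenius_def, ← map_one (frobenius K p)] at h
  rw [fieldSplit_apply, one_mul]
  exact frobenius_inj K p h

theorem theta_div_pow (hx : IsPBasis p (fun i => algebraMap A K (x i))) (j : ι) (a c : K) :
    hx.theta j (a / c ^ p) = hx.theta j a / c ^ p := by
  rw [div_eq_mul_inv, ← inv_pow, Derivation.leibniz, derivation_pow_char, smul_zero, zero_add,
    smul_eq_mul, inv_pow, mul_comm, ← div_eq_mul_inv]

/-- The divided differential sends `dlog xᵢ` to `(xᵢ ^ (p - 1) dxᵢ + ds(xᵢ)) / xᵢ ^ p = dlog xᵢ +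
d(s(xᵢ) / xᵢ ^ p)`, as `p`-th powers are constants for derivations. -/
theorem frobDet_eq (s : A → K) (hx : IsPBasis p (fun i => algebraMap A K (x i))) :
    frobDet s hx = Matrix.det (Matrix.of fun i j =>
      frobDer p s (hx.theta j) (x i) / algebraMap A K (x i) ^ p) := by
  rw [frobDet]
  congr 1
  ext i j
  have h0 := hx.ne_zero i
  rw [Matrix.add_apply, Matrix.of_apply, Matrix.of_apply, theta_div_pow, frobDer, add_div,
    hx.theta_self, Matrix.one_apply]
  congr 1
  split_ifs with h
  · rw [← pow_succ, Nat.sub_add_cancel hp.out.one_le, div_self (pow_ne_zero _ h0)]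
  · simp

/-- The divided differential is Frobenius-linear: the change of basis on its source enters through a
`p`-th power, the one on its target linearly. -/
theorem frobDet_eq_mul [IsFractionRing A K] {s : A → K} (hs : IsFrobDelta p s) {y : ι → A}
    (hx : IsPBasis p (fun i => algebraMap A K (x i)))
    (hy : IsPBasis p (fun i => algebraMap A K (y i))) :
    frobDet s hy
      = Matrix.det (Matrix.of fun i l =>
          hx.theta l (algebraMap A K (y i)) / algebraMap A K (y i)) ^ p * frobDet s hx *
        Matrix.det (Matrix.of fun i j =>
          hy.theta j (algebraMap A K (x i)) / algebraMap A K (x i)) := by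
  rw [← frobenius_def, RingHom.map_det, frobDet_eq, frobDet_eq, ← Matrix.det_mul,
    ← Matrix.det_mul, mul_assoc]
  congr 1
  ext i j
  simp only [Matrix.mul_apply, Matrix.of_apply, RingHom.mapMatrix_apply, Matrix.map_apply,
    frobenius_def]
  rw [hs.frobDer_eq hx, Finset.sum_div]
  refine Finset.sum_congr rfl fun l _ => ?_
  rw [frobDer_eq_sum hx s (hy.theta j), Finset.sum_div, Finset.sum_mul, Finset.sum_div,
    Finset.mul_sum]
  refine Finset.sum_congr rfl fun m _ => ?_
  rw [div_pow]
  ring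

/-- The splitting does not depend on the `p`-basis. -/
theorem fieldSplit_eq_of_fintype [IsFractionRing A K] {s : A → K} (hs : IsFrobDelta p s)
    {y : ι → A} (hx : IsPBasis p (fun i => algebraMap A K (x i)))
    (hy : IsPBasis p (fun i => algebraMap A K (y i))) (g : K) :
    fieldSplit s hx g = fieldSplit s hy g := by
  -- A `p⁻¹`-linear map `φ` with `φ 1 = 1` is determined by its kernel, because `g - φ(g) ^ p` lies
  -- in it. So it suffices to compare kernels.
  have key (g : K) (hg : fieldSplit s hx g = 0) : fieldSplit s hy g = 0 := by
    rw [fieldSplit_apply] at hg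
    have h (a b c : K) : g * (a ^ p * b * c) = a ^ p * (g * b * c) := by ring
    rw [fieldSplit_apply, frobDet_eq_mul hs hx hy, h, hy.coeff_pow_mul,
      hx.coeff_zero_mul_det hy hg, mul_zero]
  have h := key (g - fieldSplit s hx g ^ p * 1)
    (by rw [map_sub, fieldSplit_pow_mul, fieldSplit_one, mul_one, sub_self])
  rw [map_sub, fieldSplit_pow_mul, fieldSplit_one, mul_one, sub_eq_zero] at h
  exact h.symm

theorem fieldSplit_eq [IsFractionRing A K] {s : A → K} (hs : IsFrobDelta p s)
    {m n : ℕ} {x : Fin m → A} {y : Fin n → A} (hx : IsPBasis p (fun i => algebraMap A K (x i)))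
    (hy : IsPBasis p (fun i => algebraMap A K (y i))) (g : K) :
    fieldSplit s hx g = fieldSplit s hy g := by
  obtain rfl : m = n := by simpa using hx.card_eq hy
  exact fieldSplit_eq_of_fintype hs hx hy g

end

section
variable {p : ℕ} [hp : Fact p.Prime]

/-! ### Integrality of the splitting -/

section Integrality

variable {A : Type*} [CommRing A] {K : Type*} [Field K] [CharP K p] [Algebra A K]
  {ι : Type*} [Fintype ι] [DecidableEq ι]

/-- The quotient is the partial derivative `∂a/∂xⱼ`: a monomial that survives `θⱼ` contains `xⱼ`, so
the division needs no denominator. -/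
theorem theta_div_mem {x : ι → K} (hx : IsPBasis p x) {S : Subring K} (hxS : ∀ i, x i ∈ S)
    (hS : ∀ a ∈ S, ∀ e, hx.coeff e a ∈ S) (j : ι) {a : K} (ha : a ∈ S) :
    hx.theta j a / x j ∈ S := by
  rw [hx.theta_apply, Finset.sum_div]
  refine sum_mem fun e _ => ?_
  have h0 := hx.ne_zero j
  rcases Nat.eq_zero_or_eq_succ_pred (e j).val with h | h
  · rw [(ZMod.val_eq_zero _).mp h, map_zero, zero_mul, zero_div]
    exact zero_mem S
  · have hmon : pmon p x e
        = x j * (x j ^ (e j).val.pred * ∏ i ∈ Finset.univ.erase j, x i ^ (e i).val) := by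
      rw [pmon, ← Finset.mul_prod_erase _ _ (Finset.mem_univ j), ← mul_assoc, ← pow_succ',
        ← Nat.succ_eq_add_one, ← h]
    have hc : primeCast p K (e j) ∈ S := by
      rw [← ZMod.natCast_zmod_val (e j), map_natCast]
      exact natCast_mem S _
    rw [hx.proj_apply, hmon, ← mul_assoc, mul_left_comm _ (x j), mul_div_cancel_left₀ _ h0]
    exact S.mul_mem (S.mul_mem hc (S.pow_mem (hS a ha e) p))
      (S.mul_mem (S.pow_mem (hxS j) _) (S.prod_mem fun i _ => S.pow_mem (hxS i) _))

/-- Since `dx₁ ∧ ⋯ ∧ dxₙ = (∏ xᵢ) dlog x₁ ∧ ⋯ ∧ dlog xₙ`, this is the Cartier operator in the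
coordinates `dxᵢ`. It extracts the coefficient of degree `-1`, that is, of `∏ xᵢ ^ (p - 1)`. -/
theorem coeff_zero_mul_prod_mem {x : ι → K} (hx : IsPBasis p x) {S : Subring K}
    (hS : ∀ a ∈ S, ∀ e, hx.coeff e a ∈ S) {a : K} (ha : a ∈ S) :
    hx.coeff 0 (a * ∏ i, x i) / ∏ i, x i ∈ S := by
  have h0 : ∏ i, x i ≠ 0 := Finset.prod_ne_zero_iff.mpr fun i _ => hx.ne_zero i
  have hprod : IsHomog p x 1 (∏ i, x i) := by
    have := IsHomog.prod (p := p) (x := x) Finset.univ fun i _ => isHomog_self i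
    convert this
    exact (Finset.univ_sum_single (1 : ι → ZMod p)).symm
  have key : hx.coeff 0 (a * ∏ i, x i) = hx.coeff (-1) a * ∏ i, x i := by
    conv_lhs => rw [← hx.sum_proj a, Finset.sum_mul, map_sum]
    rw [Finset.sum_eq_single (-1)]
    · have hm : pmon p x (-1) * ∏ i, x i = (∏ i, x i) ^ p * pmon p x 0 := by
        rw [pmon_zero, mul_one, pmon, ← Finset.prod_mul_distrib, ← Finset.prod_pow]
        refine Finset.prod_congr rfl fun i _ => ?_
        obtain ⟨n, hn⟩ := Nat.exists_eq_succ_of_ne_zero hp.out.ne_zero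
        subst hn
        rw [Pi.neg_apply, Pi.one_apply, ZMod.val_neg_one, ← pow_succ]
      rw [hx.proj_apply, mul_assoc, hm, hx.coeff_pow_mul, hx.coeff_mul_pmon, if_pos rfl]
    · intro e _ he
      rw [hx.coeff_zero_eq_zero_iff, hx.proj_eq_of_isHomog ((hx.isHomog_proj e a).mul hprod),
        if_neg]
      intro h
      exact he (eq_neg_of_add_eq_zero_left h.symm)
    · simp
  rw [key, mul_div_cancel_right₀ _ h0]
  exact hS a ha _

theorem fieldSplit_mem {x : ι → A} {s : A → K}
    (hx : IsPBasis p (fun i => algebraMap A K (x i))) {S : Subring K}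
    (hxS : ∀ i, algebraMap A K (x i) ∈ S) (hs : ∀ i, s (x i) ∈ S)
    (hS : ∀ a ∈ S, ∀ e, hx.coeff e a ∈ S) {g : K} (hg : g ∈ S) : fieldSplit s hx g ∈ S := by
  let y (i : ι) : K := algebraMap A K (x i)
  have hy (i : ι) : y i ≠ 0 := hx.ne_zero i
  -- The matrix of the divided differential in the basis `dxᵢ`, whose entries lie in `S`; returning
  -- to logarithmic coordinates costs only `∏ xᵢ` and a `p`-th power of its inverse.
  let N : Matrix ι ι K := Matrix.of fun i j =>
    (if i = j then y i ^ (p - 1) else 0) + hx.theta j (s (x i)) / y j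
  have hN : N.det ∈ S := by
    rw [Matrix.det_apply]
    refine sum_mem fun σ _ => ?_
    refine Subring.zsmul_mem _ (S.prod_mem fun i _ => ?_) _
    refine S.add_mem ?_ (theta_div_mem hx hxS hS i (hs _))
    split_ifs
    · exact S.pow_mem (hxS _) _
    · exact S.zero_mem
  have hdet : frobDet s hx = (∏ i, (y i)⁻¹) ^ p * (N.det * ∏ i, y i) := by
    have : (1 + Matrix.of fun i j => hx.theta j (s (x i) / algebraMap A K (x i) ^ p))
        = Matrix.of fun i j => (y i)⁻¹ ^ p * (Matrix.of fun i j => y j * N i j) i j := by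
      ext i j
      simp only [Matrix.add_apply, Matrix.of_apply, theta_div_pow, N]
      rw [mul_add, mul_div_cancel₀ _ (hy j), mul_add, Matrix.one_apply]
      congr 1
      · split_ifs with h
        · subst h
          rw [← pow_succ', Nat.sub_add_cancel hp.out.one_le, inv_pow,
            inv_mul_cancel₀ (pow_ne_zero _ (hy i))]
        · simp
      · rw [inv_pow, mul_comm, ← div_eq_mul_inv]
    rw [frobDet, this, Matrix.det_mul_column, Matrix.det_mul_row, Finset.prod_pow,
      mul_comm (∏ i, y i)]
  rw [fieldSplit_apply, hdet, mul_left_comm, hx.coeff_pow_mul, Finset.prod_inv_distrib,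
    ← mul_assoc, mul_comm, ← div_eq_mul_inv]
  exact coeff_zero_mul_prod_mem hx hS (S.mul_mem hg hN)

end Integrality

/-! ### `F`-finite rings -/

/-- `R` is finite over its subring of `p`-th powers. -/
def IsFFinite (p : ℕ) (R : Type*) [CommRing R] : Prop :=
  ∃ (n : ℕ) (v : Fin n → R), ∀ a, ∃ c : Fin n → R, a = ∑ i, c i ^ p * v i

theorem IsFFinite.of_surjective {R S : Type*} [CommRing R] [CommRing S] (h : IsFFinite p R)
    (f : R →+* S) (hf : Function.Surjective f) : IsFFinite p S := by
  obtain ⟨n, v, hv⟩ := h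
  refine ⟨n, f ∘ v, fun a => ?_⟩
  obtain ⟨a, rfl⟩ := hf a
  obtain ⟨c, hc⟩ := hv a
  exact ⟨f ∘ c, by conv_lhs => rw [hc]
                   simp⟩

theorem IsFFinite.of_isLocalization {R S : Type*} [CommRing R] [CommRing S] [Algebra R S]
    (h : IsFFinite p R) (M : Submonoid R) [IsLocalization M S] : IsFFinite p S := by
  obtain ⟨n, v, hv⟩ := h
  refine ⟨n, algebraMap R S ∘ v, fun a => ?_⟩
  obtain ⟨a, m, rfl⟩ := IsLocalization.exists_mk'_eq M a
  -- The denominator is made a `p`-th power: `a / m = a m ^ (p - 1) / m ^ p`.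
  obtain ⟨c, hc⟩ := hv (a * (m : R) ^ (p - 1))
  refine ⟨fun i => IsLocalization.mk' S (c i) m, ?_⟩
  have hu : IsUnit (algebraMap R S m ^ p) := (IsLocalization.map_units S m).pow p
  rw [← hu.mul_right_inj, Finset.mul_sum]
  have h1 : algebraMap R S m ^ p * IsLocalization.mk' S a m
      = algebraMap R S (a * (m : R) ^ (p - 1)) := by
    obtain ⟨q, hq⟩ := Nat.exists_eq_succ_of_ne_zero hp.out.ne_zero
    rw [hq, Nat.succ_eq_add_one, pow_succ, mul_assoc, IsLocalization.mk'_spec', map_mul, map_pow,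
      Nat.add_sub_cancel, mul_comm]
  rw [h1, hc, map_sum]
  refine Finset.sum_congr rfl fun i _ => ?_
  rw [← mul_assoc, ← mul_pow, IsLocalization.mk'_spec', map_mul, map_pow, Function.comp_apply]

/-- `a` is a sum of `p`-th powers times monomials in `x`. -/
def IsPmonSum (p : ℕ) [Fact p.Prime] {R : Type*} [CommRing R] {ι : Type*} [Fintype ι]
    [DecidableEq ι] (x : ι → R) (a : R) : Prop :=
  ∃ c : (ι → ZMod p) → R, a = ∑ e, c e ^ p * pmon p x e

section PmonSum

variable {R : Type*} [CommRing R] {ι : Type*} [Fintype ι] [DecidableEq ι] {x : ι → R}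

theorem IsHomog.isPmonSum {e : ι → ZMod p} {a : R} (ha : IsHomog p x e a) :
    IsPmonSum p x a := by
  obtain ⟨c, rfl⟩ := ha
  refine ⟨Pi.single e c, ?_⟩
  rw [Finset.sum_eq_single e]
  · simp
  · intro f _ hf
    simp [Pi.single_eq_of_ne hf, hp.out.ne_zero]
  · simp

variable [CharP R p]

theorem IsPmonSum.add {a b : R} (ha : IsPmonSum p x a) (hb : IsPmonSum p x b) :
    IsPmonSum p x (a + b) := by
  obtain ⟨c, rfl⟩ := ha
  obtain ⟨d, rfl⟩ := hb
  exact ⟨c + d, by simp only [Pi.add_apply, add_pow_char, add_mul, Finset.sum_add_distrib]⟩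

theorem IsPmonSum.sum {κ : Type*} (s : Finset κ) {a : κ → R}
    (ha : ∀ k ∈ s, IsPmonSum p x (a k)) : IsPmonSum p x (∑ k ∈ s, a k) :=
  Finset.sum_induction a (IsPmonSum p x) (fun _ _ => IsPmonSum.add) (isHomog_zero 0).isPmonSum ha

theorem IsPmonSum.mul {a b : R} (ha : IsPmonSum p x a) (hb : IsPmonSum p x b) :
    IsPmonSum p x (a * b) := by
  obtain ⟨c, rfl⟩ := ha
  obtain ⟨d, rfl⟩ := hb
  rw [Finset.sum_mul_sum]
  exact .sum _ fun e _ => .sum _ fun f _ =>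
    (IsHomog.mul ⟨c e, rfl⟩ ⟨d f, rfl⟩).isPmonSum

end PmonSum

/-- Constants are `p`-th powers since `k` is perfect, so the monomials in the generators with
exponents below `p` suffice. -/
theorem isFFinite_of_finiteType {k R : Type*} [Field k] [CharP k p] [PerfectField k] [CommRing R]
    [CharP R p] [Algebra k R] [Algebra.FiniteType k R] : IsFFinite p R := by
  obtain ⟨n, f, hf⟩ := Algebra.FiniteType.iff_quotient_mvPolynomial''.mp ‹Algebra.FiniteType k R›
  let x (i : Fin n) : R := f (MvPolynomial.X i)
  have key (a : MvPolynomial (Fin n) k) : IsPmonSum p x (f a) := by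
    induction a using MvPolynomial.induction_on with
    | C a =>
      have : PerfectRing k p := PerfectField.toPerfectRing p
      obtain ⟨b, rfl⟩ := (bijective_frobenius k p).2 a
      rw [frobenius_def, map_pow, map_pow]
      exact (isHomog_pow _).isPmonSum
    | add a b ha hb =>
      rw [map_add]
      exact ha.add hb
    | mul_X a i ha =>
      rw [map_mul]
      exact ha.mul (isHomog_self i).isPmonSum
  let eq := Fintype.equivFin (Fin n → ZMod p)
  refine ⟨Fintype.card (Fin n → ZMod p), fun i => pmon p x (eq.symm i), fun a => ?_⟩
  obtain ⟨a, rfl⟩ := hf a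
  obtain ⟨c, hc⟩ := key a
  refine ⟨fun i => c (eq.symm i), ?_⟩
  rw [hc]
  exact (eq.symm.sum_comp fun e => c e ^ p * pmon p x e).symm

end

section
variable {p : ℕ} [hp : Fact p.Prime]

/-! ### Existence of `p`-bases -/

theorem sum_pmon_cons {R : Type*} [CommRing R] {n : ℕ} (t : R) (x : Fin n → R)
    (c : (Fin (n + 1) → ZMod p) → R) :
    ∑ e, c e ^ p * pmon p (Fin.cons t x : Fin (n + 1) → R) e
      = ∑ i : ZMod p, (∑ e : Fin n → ZMod p, c (Fin.cons i e) ^ p * pmon p x e) * t ^ i.val := by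
  rw [← (Fin.consEquiv fun _ : Fin (n + 1) => ZMod p).sum_comp, Fintype.sum_prod_type]
  refine Finset.sum_congr rfl fun i _ => ?_
  rw [Finset.sum_mul]
  refine Finset.sum_congr rfl fun e _ => ?_
  simp only [Fin.consEquiv, Equiv.coe_fn_mk, pmon, Fin.prod_univ_succ, Fin.cons_zero, Fin.cons_succ]
  ring

theorem span_range_eq_top {k M κ : Type*} [CommRing k] [AddCommGroup M] [Module k M] [Fintype κ]
    {w : κ → M} (hw : ∀ a, ∃ c : κ → k, a = ∑ i, c i • w i) :
    Submodule.span k (Set.range w) = ⊤ := by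
  refine Submodule.eq_top_iff'.mpr fun a => (Submodule.mem_span_range_iff_exists_fun k).mpr ?_
  obtain ⟨c, hc⟩ := hw a
  exact ⟨c, hc.symm⟩

theorem card_le_card_of_semilinear {k M ι κ : Type*} [Field k] [AddCommGroup M] [Module k M]
    [Fintype ι] [Fintype κ] (v : ι → M) (w : κ → M)
    (hv : ∀ c : ι → k, ∑ i, c i • v i = 0 → c = 0)
    (hw : ∀ a, ∃ c : κ → k, a = ∑ i, c i • w i) : Fintype.card ι ≤ Fintype.card κ := by
  have hspan := span_range_eq_top hw
  have : Module.Finite k M := ⟨hspan ▸ Submodule.fg_span (Set.finite_range w)⟩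
  have hli : LinearIndependent k v :=
    Fintype.linearIndependent_iff.mpr fun c hc => congrFun (hv c hc)
  refine hli.fintype_card_le_finrank.trans ?_
  have h := finrank_range_le_card (R := k) (b := w)
  rwa [Set.finrank, hspan, finrank_top] at h

/-- The monomials in `x` are linearly independent over the `p`-th powers. -/
def IsPIndep (p : ℕ) [Fact p.Prime] {R : Type*} [CommRing R] {ι : Type*} [Fintype ι]
    [DecidableEq ι] (x : ι → R) : Prop :=
  ∀ c : (ι → ZMod p) → R, ∑ e, c e ^ p * pmon p x e = 0 → c = 0

theorem isPBasis_iff {R : Type*} [CommRing R] [IsDomain R] [CharP R p] {ι : Type*} [Fintype ι]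
    [DecidableEq ι] {x : ι → R} :
    IsPBasis p x ↔ IsPIndep p x ∧ ∀ a, IsPmonSum p x a := by
  refine and_congr ⟨fun h c hc => h ?_, fun h c d hcd => ?_⟩ ?_
  · simpa [hp.out.ne_zero] using hc
  · rw [← sub_eq_zero]
    refine h _ ?_
    dsimp only at hcd
    simp only [Pi.sub_apply, sub_pow_char, sub_mul, Finset.sum_sub_distrib, hcd, sub_self]
  · exact forall_congr' fun a => exists_congr fun c => eq_comm

section Field

variable {L : Type*} [Field L] [CharP L p]

/-- The `p ^ m` monomials are independent for the action of `L` on itself through Frobenius, so `m ≤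
p ^ m ≤ n`. This crude bound gives a `p`-independent family of maximal length. -/
theorem IsFFinite.card_le {n m : ℕ} {v : Fin n → L}
    (hv : ∀ a, ∃ c : Fin n → L, a = ∑ i, c i ^ p * v i) {x : Fin m → L} (hx : IsPIndep p x) :
    m ≤ n := by
  have := @card_le_card_of_semilinear L L (Fin m → ZMod p) (Fin n) _ _
    (Module.compHom L (frobenius L p)) _ _ (pmon p x) v hx hv
  rw [Fintype.card_fun, ZMod.card, Fintype.card_fin, Fintype.card_fin] at this
  exact (Nat.lt_pow_self hp.out.one_lt).le.trans this

/-- By injectivity of Frobenius `y ^ p` is not a `p`-th power in `T`, so `X ^ p - y ^ p` is the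
minimal polynomial of `y` and its powers below `p` are independent. -/
theorem sum_mul_pow_eq_zero_imp {T : Subfield L} {y : L} (hy : y ∉ T) (hyp : y ^ p ∈ T)
    {t : ZMod p → L} (ht : ∀ i, t i ∈ T) (h : ∑ i, t i * y ^ i.val = 0) (i : ZMod p) :
    t i = 0 := by
  have hirr : Irreducible (Polynomial.X ^ p - Polynomial.C (⟨y ^ p, hyp⟩ : T)) := by
    refine X_pow_sub_C_irreducible_of_prime hp.out fun b hb => hy ?_
    have : (b : L) ^ p = y ^ p := congrArg Subtype.val hb
    rw [← frobenius_inj L p this]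
    exact b.2
  have hmin : minpoly T y = Polynomial.X ^ p - Polynomial.C (⟨y ^ p, hyp⟩ : T) := by
    symm
    refine minpoly.eq_of_irreducible_of_monic hirr ?_
      (Polynomial.monic_X_pow_sub_C _ hp.out.ne_zero)
    rw [map_sub, map_pow, Polynomial.aeval_X, Polynomial.aeval_C]
    exact sub_self _
  let f : Polynomial T := ∑ i : ZMod p, Polynomial.monomial i.val ⟨t i, ht i⟩
  have hdeg : f.degree < p := by
    refine (Polynomial.degree_sum_le _ _).trans_lt ?_
    refine (Finset.sup_lt_iff (show ⊥ < (p : WithBot ℕ) from WithBot.bot_lt_coe p)).mpr fun i _ => ?_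
    exact (Polynomial.degree_monomial_le _ _).trans_lt (Nat.cast_lt.mpr (ZMod.val_lt i))
  have hf : f = 0 := by
    by_contra hf0
    have h1 := minpoly.degree_le_of_ne_zero T y hf0 (by
      rw [map_sum, ← h]
      refine Finset.sum_congr rfl fun i _ => ?_
      rw [Polynomial.aeval_monomial]
      rfl)
    rw [hmin, Polynomial.degree_X_pow_sub_C hp.out.pos] at h1
    exact absurd hdeg h1.not_gt
  have hc := congrArg (fun g => Polynomial.coeff g i.val) hf
  simp only [f, Polynomial.finsetSum_coeff, Polynomial.coeff_monomial, Polynomial.coeff_zero] at hc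
  rw [Finset.sum_eq_single i (fun j _ hj => if_neg fun h => hj (ZMod.val_injective p h))
    (by simp), if_pos rfl] at hc
  exact congrArg Subtype.val hc

/-- The subfield generated by `x` over the `p`-th powers. -/
def pmonSubfield (p : ℕ) [hp : Fact p.Prime] {L : Type*} [Field L] [CharP L p] {n : ℕ}
    (x : Fin n → L) : Subfield L where
  carrier := {a | IsPmonSum p x a}
  mul_mem' := IsPmonSum.mul
  add_mem' := IsPmonSum.add
  one_mem' := isHomog_one.isPmonSum
  zero_mem' := (isHomog_zero 0).isPmonSum
  neg_mem' {a} ha := by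
    have := (isHomog_primeCast_mul (p := p) (x := x) (-1) isHomog_one).isPmonSum.mul ha
    simpa using this
  inv_mem' a ha := by
    by_cases h : a = 0
    · rw [h, inv_zero]
      exact (isHomog_zero 0).isPmonSum
    · have hpow (n : ℕ) : IsPmonSum p x (a ^ n) := by
        induction n with
        | zero => simpa using isHomog_one.isPmonSum
        | succ n ih => rw [pow_succ]; exact ih.mul ha
      -- The inverse is `a⁻¹ = a ^ (p - 1) * (a⁻¹) ^ p`.
      have := (hpow (p - 1)).mul (isHomog_pow (p := p) (x := x) a⁻¹).isPmonSum
      convert this using 1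
      rw [inv_pow, ← pow_sub_one_mul hp.out.ne_zero a, mul_inv,
        mul_inv_cancel_left₀ (pow_ne_zero _ h)]
      exact Iff.rfl

theorem IsFFinite.exists_isPBasis (h : IsFFinite p L) :
    ∃ (n : ℕ) (x : Fin n → L), IsPBasis p x := by
  obtain ⟨N, v, hv⟩ := h
  let P (m : ℕ) : Prop := ∃ x : Fin m → L, IsPIndep p x
  classical
  have h0 : P 0 := by
    refine ⟨Fin.elim0, fun c hc => funext fun e => ?_⟩
    rw [Fintype.sum_eq_single e fun f hf => absurd (Subsingleton.elim f e) hf] at hc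
    rw [pmon, Finset.univ_eq_empty, Finset.prod_empty, mul_one] at hc
    exact (pow_eq_zero_iff hp.out.ne_zero).mp hc
  have hbound (m : ℕ) (hm : P m) : m ≤ N := by
    obtain ⟨x, hx⟩ := hm
    exact IsFFinite.card_le hv hx
  obtain ⟨x, hx⟩ : P (Nat.findGreatest P N) := Nat.findGreatest_spec (Nat.zero_le N) h0
  refine ⟨_, x, isPBasis_iff.mpr ⟨hx, fun y => ?_⟩⟩
  by_contra hy
  have hsucc : P (Nat.findGreatest P N + 1) := by
    refine ⟨Fin.cons y x, fun c hc => ?_⟩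
    rw [sum_pmon_cons] at hc
    have := sum_mul_pow_eq_zero_imp (T := pmonSubfield p x) hy (isHomog_pow y).isPmonSum
      (fun i => ⟨_, rfl⟩) hc
    funext e
    have h1 := congrFun (hx _ (this (e 0))) (Fin.tail e)
    rwa [Fin.cons_self_tail] at h1
  have := Nat.le_findGreatest (hbound _ hsucc) hsucc
  omega

end Field

/-! ### `p`-bases of discrete valuation rings -/

/-- Nakayama's lemma, stated for a separate module `M` so that it applies to `R` acting on itself by
`c • a = c ^ p * a`. -/
theorem exists_sum_of_le_jacobson {R M ι : Type*} [CommRing R] [AddCommGroup M] [Module R M]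
    [Fintype ι] (v : ι → M) {n : ℕ} (w : Fin n → M) (t : R) (ht : t ∈ Ideal.jacobson (⊥ : Ideal R))
    (hw : ∀ a, ∃ c : Fin n → R, a = ∑ i, c i • w i)
    (hv : ∀ a, ∃ (c : ι → R) (b : M), a = ∑ i, c i • v i + t • b) (a : M) :
    ∃ c : ι → R, a = ∑ i, c i • v i := by
  have hfg : (⊤ : Submodule R M).FG := by
    rw [← span_range_eq_top hw]
    exact Submodule.fg_span (Set.finite_range w)
  have hle : (⊤ : Submodule R M) ≤ Submodule.span R (Set.range v) := by
    refine Submodule.le_of_le_smul_of_le_jacobson_bot hfg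
      ((Ideal.span_singleton_le_iff_mem _).mpr ht) fun a _ => ?_
    obtain ⟨c, b, rfl⟩ := hv a
    refine Submodule.add_mem_sup (sum_mem fun i _ => Submodule.smul_mem _ _
      (Submodule.subset_span ⟨i, rfl⟩)) ?_
    exact Submodule.smul_mem_smul (Ideal.mem_span_singleton_self t) trivial
  obtain ⟨c, hc⟩ := (Submodule.mem_span_range_iff_exists_fun R).mp (hle (Submodule.mem_top (x := a)))
  exact ⟨c, hc.symm⟩

section DVR

variable {R : Type*} [CommRing R] [IsDomain R] [IsLocalRing R] [IsNoetherianRing R] [CharP R p]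
  {t : R} {n : ℕ} {x : Fin n → R}

theorem dvd_of_residue_eq_zero (ht : IsLocalRing.maximalIdeal R = Ideal.span {t}) {a : R}
    (ha : IsLocalRing.residue R a = 0) : t ∣ a := by
  rw [← Ideal.mem_span_singleton, ← ht]
  exact (IsLocalRing.residue_eq_zero_iff a).mp ha

theorem dvd_of_dvd_sum_pmon (ht : IsLocalRing.maximalIdeal R = Ideal.span {t})
    [CharP (IsLocalRing.ResidueField R) p]
    (hx : IsPBasis p (fun i => IsLocalRing.residue R (x i))) {c : (Fin n → ZMod p) → R}
    (h : t ∣ ∑ e, c e ^ p * pmon p x e) (e : Fin n → ZMod p) : t ∣ c e := by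
  apply dvd_of_residue_eq_zero ht
  have h0 : IsLocalRing.residue R (∑ e, c e ^ p * pmon p x e) = 0 := by
    rw [IsLocalRing.residue_eq_zero_iff, ht, Ideal.mem_span_singleton]
    exact h
  rw [map_sum] at h0
  refine congrFun ((isPBasis_iff.mp hx).1 (fun e => IsLocalRing.residue R (c e)) ?_) e
  rw [← h0]
  exact Finset.sum_congr rfl fun e _ => by simp [pmon]

/-- Induction on the exponent `i` of `t`: terms with smaller exponent are already divisible by `t ^
p`, those with larger exponent by `t ^ (i + 1)`. So `t` divides the coefficient of `t ^ i`, and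
independence over the residue field applies. -/
theorem dvd_of_sum_pmon_cons_eq_zero (ht : IsLocalRing.maximalIdeal R = Ideal.span {t})
    (ht0 : t ≠ 0) [CharP (IsLocalRing.ResidueField R) p]
    (hx : IsPBasis p (fun i => IsLocalRing.residue R (x i))) {c : (Fin (n + 1) → ZMod p) → R}
    (h : ∑ e, c e ^ p * pmon p (Fin.cons t x : Fin (n + 1) → R) e = 0)
    (e : Fin (n + 1) → ZMod p) : t ∣ c e := by
  rw [sum_pmon_cons] at h
  suffices H : ∀ (m : ℕ) (i : ZMod p), i.val = m → ∀ e : Fin n → ZMod p, t ∣ c (Fin.cons i e) by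
    have := H _ (e 0) rfl (Fin.tail e)
    rwa [Fin.cons_self_tail] at this
  intro m
  induction m using Nat.strong_induction_on with
  | _ m ih =>
  rintro i rfl
  apply dvd_of_dvd_sum_pmon ht hx
  rw [← mul_dvd_mul_iff_right (pow_ne_zero i.val ht0), ← pow_succ']
  rw [← Finset.add_sum_erase _ _ (Finset.mem_univ i), add_eq_zero_iff_eq_neg] at h
  rw [h, dvd_neg]
  refine Finset.dvd_sum fun j hj => ?_
  have hne : j.val ≠ i.val := fun h => Finset.ne_of_mem_erase hj (ZMod.val_injective p h)
  rcases hne.lt_or_gt with hlt | hgt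
  · refine Dvd.dvd.mul_right (Finset.dvd_sum fun e _ => Dvd.dvd.mul_right ?_ _) _
    exact (pow_dvd_pow t (ZMod.val_lt i)).trans (pow_dvd_pow_of_dvd (ih _ hlt j rfl e) p)
  · exact Dvd.dvd.mul_left (pow_dvd_pow t hgt) _

theorem isPIndep_cons (ht : IsLocalRing.maximalIdeal R = Ideal.span {t})
    (ht0 : t ≠ 0) [CharP (IsLocalRing.ResidueField R) p]
    (hx : IsPBasis p (fun i => IsLocalRing.residue R (x i))) :
    IsPIndep p (Fin.cons t x : Fin (n + 1) → R) := by
  intro c hc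
  -- Dividing all coefficients by `t` gives another relation, so the descent never stops; Krull's
  -- intersection theorem then forces them to vanish.
  have key (m : ℕ) : ∀ c : (Fin (n + 1) → ZMod p) → R,
      ∑ e, c e ^ p * pmon p (Fin.cons t x : Fin (n + 1) → R) e = 0 → ∀ e, t ^ m ∣ c e := by
    induction m with
    | zero => simp
    | succ m ih =>
      intro c hc e
      choose d hd using dvd_of_sum_pmon_cons_eq_zero ht ht0 hx hc
      rw [hd, pow_succ']
      refine mul_dvd_mul_left t (ih d ?_ e)
      have : t ^ p * ∑ e, d e ^ p * pmon p (Fin.cons t x : Fin (n + 1) → R) e = 0 := by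
        rw [← hc, Finset.mul_sum]
        exact Finset.sum_congr rfl fun e _ => by rw [hd e, mul_pow, mul_assoc]
      exact (mul_eq_zero.mp this).resolve_left (pow_ne_zero _ ht0)
  funext e
  have hbot := Ideal.iInf_pow_eq_bot_of_isLocalRing (IsLocalRing.maximalIdeal R)
    (IsLocalRing.maximalIdeal.isMaximal R).ne_top
  have hmem : c e ∈ ⨅ i : ℕ, IsLocalRing.maximalIdeal R ^ i := by
    rw [Submodule.mem_iInf]
    intro m
    rw [ht, Ideal.span_singleton_pow, Ideal.mem_span_singleton]
    exact key m c hc e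
  rw [hbot] at hmem
  exact hmem

theorem sum_zmod_val {M : Type*} [AddCommMonoid M] (f : ℕ → M) :
    ∑ i : ZMod p, f i.val = ∑ i ∈ Finset.range p, f i := by
  refine Finset.sum_bij' (fun i _ => i.val) (fun m _ => (m : ZMod p)) ?_ ?_ ?_ ?_ ?_
  · exact fun i _ => Finset.mem_range.mpr (ZMod.val_lt i)
  · exact fun _ _ => Finset.mem_univ _
  · exact fun i _ => ZMod.natCast_zmod_val i
  · exact fun m hm => ZMod.val_cast_of_lt (Finset.mem_range.mp hm)
  · exact fun _ _ => rfl

theorem isPBasis_cons (ht : IsLocalRing.maximalIdeal R = Ideal.span {t})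
    (ht0 : t ≠ 0) [CharP (IsLocalRing.ResidueField R) p] (hR : IsFFinite p R)
    (hx : IsPBasis p (fun i => IsLocalRing.residue R (x i))) :
    IsPBasis p (Fin.cons t x : Fin (n + 1) → R) := by
  refine isPBasis_iff.mpr ⟨isPIndep_cons ht ht0 hx, ?_⟩
  have step (a : R) : ∃ (c : (Fin n → ZMod p) → R) (b : R),
      a = ∑ e, c e ^ p * pmon p x e + t * b := by
    obtain ⟨c, hc⟩ := hx.2 (IsLocalRing.residue R a)
    choose d hd using fun e => IsLocalRing.residue_surjective (c e)
    obtain ⟨b, hb⟩ := dvd_of_residue_eq_zero ht (a := a - ∑ e, d e ^ p * pmon p x e) (by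
      rw [map_sub, ← hc, map_sum, sub_eq_zero]
      exact Finset.sum_congr rfl fun e _ => by simp [pmon, hd])
    exact ⟨d, b, by rw [← hb]; ring⟩
  have steps (m : ℕ) (a : R) : ∃ (c : ℕ → (Fin n → ZMod p) → R) (b : R),
      a = ∑ i ∈ Finset.range m, (∑ e, c i e ^ p * pmon p x e) * t ^ i + t ^ m * b := by
    induction m with
    | zero => exact ⟨0, a, by simp⟩
    | succ m ih =>
      obtain ⟨c, b, hb⟩ := ih
      obtain ⟨d, b', hb'⟩ := step b
      refine ⟨Function.update c m d, b', ?_⟩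
      rw [Finset.sum_range_succ, Function.update_self]
      have : ∑ i ∈ Finset.range m, (∑ e, Function.update c m d i e ^ p * pmon p x e) * t ^ i
          = ∑ i ∈ Finset.range m, (∑ e, c i e ^ p * pmon p x e) * t ^ i :=
        Finset.sum_congr rfl fun i hi => by
          rw [Function.update_of_ne (Finset.mem_range.mp hi).ne]
      rw [this, hb]
      conv_lhs => rw [hb']
      ring
  obtain ⟨N, w, hw⟩ := hR
  have hj : t ∈ Ideal.jacobson (⊥ : Ideal R) := by
    rw [IsLocalRing.jacobson_eq_maximalIdeal _ bot_ne_top, ht]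
    exact Ideal.mem_span_singleton_self t
  -- Expanding to `t`-adic order `p` leaves a remainder `t ^ p * b`, which is `t • b` for the
  -- Frobenius action, as Nakayama requires.
  refine @exists_sum_of_le_jacobson R R (Fin (n + 1) → ZMod p) _ _
    (Module.compHom R (frobenius R p)) _ (pmon p (Fin.cons t x : Fin (n + 1) → R)) N w t hj hw
    fun a => ?_
  obtain ⟨c, b, hb⟩ := steps p a
  refine ⟨fun e => c (e 0).val (Fin.tail e), b, ?_⟩
  change a = ∑ e : Fin (n + 1) → ZMod p, c (e 0).val (Fin.tail e) ^ p *
    pmon p (Fin.cons t x : Fin (n + 1) → R) e + t ^ p * b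
  rw [sum_pmon_cons (c := fun e => c (e 0).val (Fin.tail e)), hb, ← sum_zmod_val]
  simp only [Fin.cons_zero, Fin.tail_cons]

end DVR

/-! ### Passage to the fraction field -/

section FractionField

variable {R : Type*} [CommRing R] [IsDomain R] {K : Type*} [Field K] [CharP K p]
  [Algebra R K] [IsFractionRing R K] {ι : Type*} [Fintype ι] [DecidableEq ι] {x : ι → R}

theorem algebraMap_sum_pmon (c : (ι → ZMod p) → R) :
    algebraMap R K (∑ e, c e ^ p * pmon p x e)
      = ∑ e, algebraMap R K (c e) ^ p * pmon p (fun i => algebraMap R K (x i)) e := by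
  simp [pmon]

theorem IsPBasis.toFractionField (hx : IsPBasis p x) :
    IsPBasis p (fun i => algebraMap R K (x i)) := by
  refine isPBasis_iff.mpr ⟨fun c hc => ?_, fun a => ?_⟩
  · obtain ⟨b, hb⟩ := IsLocalization.exist_integer_multiples (nonZeroDivisors R) Finset.univ c
    choose d hd using fun e => hb e (Finset.mem_univ e)
    have hb0 : algebraMap R K b ≠ 0 := (IsLocalization.map_units K b).ne_zero
    have h0 : (fun c : (ι → ZMod p) → R => ∑ e, c e ^ p * pmon p x e) d
        = (fun c : (ι → ZMod p) → R => ∑ e, c e ^ p * pmon p x e) 0 := by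
      apply IsFractionRing.injective R K
      dsimp only
      rw [algebraMap_sum_pmon, algebraMap_sum_pmon]
      simp only [hd, Algebra.smul_def, mul_pow, mul_assoc, ← Finset.mul_sum, hc]
      simp [hp.out.ne_zero]
    have hd0 := hx.1 h0
    funext e
    have := hd e
    rw [hd0, Pi.zero_apply, map_zero, Algebra.smul_def, eq_comm, mul_eq_zero] at this
    exact this.resolve_left hb0
  · obtain ⟨a, b, hb, rfl⟩ := IsFractionRing.div_surjective (A := R) a
    have hb0 : algebraMap R K b ≠ 0 :=
      IsFractionRing.to_map_ne_zero_of_mem_nonZeroDivisors hb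
    obtain ⟨c, hc⟩ := hx.2 (a * b ^ (p - 1))
    refine ⟨fun e => algebraMap R K (c e) / algebraMap R K b, ?_⟩
    have h1 := congrArg (algebraMap R K) hc
    dsimp only at h1
    rw [algebraMap_sum_pmon] at h1
    simp only [div_pow, div_mul_eq_mul_div, ← Finset.sum_div, h1]
    obtain ⟨q, hq⟩ := Nat.exists_eq_succ_of_ne_zero hp.out.ne_zero
    rw [map_mul, map_pow, hq, Nat.succ_sub_one, pow_succ]
    field_simp

theorem IsPBasis.coeff_algebraMap_mem_range (hx : IsPBasis p x) (a : R) (e : ι → ZMod p) :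
    (hx.toFractionField (K := K)).coeff e (algebraMap R K a) ∈ (algebraMap R K).range := by
  obtain ⟨c, hc⟩ := hx.2 a
  refine ⟨c e, ?_⟩
  change _ = hx.toFractionField.repr _ e
  rw [hx.toFractionField.repr_eq (c := fun e => algebraMap R K (c e))]
  rw [← hc]
  exact (algebraMap_sum_pmon c).symm

end FractionField
end

section
variable {p : ℕ} [hp : Fact p.Prime]

/-! ### The splitting of a normal domain -/

theorem IsPBasis.mul_units_pow {R : Type*} [CommRing R] [IsDomain R] [CharP R p] {ι : Type*}
    [Fintype ι] [DecidableEq ι] {x : ι → R} (hx : IsPBasis p x) (b : ι → Rˣ) :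
    IsPBasis p (fun i => (b i : R) ^ p * x i) := by
  let m (e : ι → ZMod p) : Rˣ := ∏ i, b i ^ (e i).val
  have hmon (e : ι → ZMod p) : pmon p (fun i => (b i : R) ^ p * x i) e
      = (m e : R) ^ p * pmon p x e := by
    simp only [pmon, m, Units.coe_prod, Units.val_pow_eq_pow_val, ← Finset.prod_pow,
      ← Finset.prod_mul_distrib, mul_pow]
    exact Finset.prod_congr rfl fun i _ => by rw [pow_right_comm]
  obtain ⟨h1, h2⟩ := isPBasis_iff.mp hx
  refine isPBasis_iff.mpr ⟨fun c hc => ?_, fun a => ?_⟩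
  · have := h1 (fun e => c e * m e) (by
      rw [← hc]
      exact Finset.sum_congr rfl fun e _ => by rw [hmon, mul_pow, mul_assoc])
    funext e
    exact (mul_eq_zero.mp (congrFun this e)).resolve_right (m e).ne_zero
  · obtain ⟨c, hc⟩ := h2 a
    refine ⟨fun e => c e * ↑(m e)⁻¹, hc.trans (Finset.sum_congr rfl fun e _ => ?_)⟩
    rw [hmon, ← mul_assoc, ← mul_pow, Units.inv_mul_cancel_right]

/-- Multiplying `a / m` by `m ^ p` keeps a `p`-basis and clears the denominator. The members must
lie in `A`, where `s` is defined. -/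
theorem IsPBasis.exists_isPBasis_algebraMap {A R : Type*} [CommRing A] [CommRing R] [IsDomain R]
    [CharP R p] [Algebra A R] (M : Submonoid A) [IsLocalization M R] {ι : Type*} [Fintype ι]
    [DecidableEq ι] {x : ι → R} (hx : IsPBasis p x) :
    ∃ y : ι → A, IsPBasis p (fun i => algebraMap A R (y i)) := by
  choose a m ham using fun i => IsLocalization.exists_mk'_eq M (x i)
  refine ⟨fun i => (m i : A) ^ (p - 1) * a i, ?_⟩
  have := hx.mul_units_pow fun i => (IsLocalization.map_units R (m i)).unit
  convert this using 2 with i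
  rw [IsUnit.unit_spec, ← ham, ← pow_sub_one_mul hp.out.ne_zero (algebraMap A R (m i)), mul_assoc,
    IsLocalization.mk'_spec', map_mul, map_pow]

/-- A noetherian integrally closed domain is the intersection of its localizations at primes
whose extension to the localization is principal. -/
theorem exists_prime_of_notMem_range {A : Type*} [CommRing A] [IsDomain A] [IsNoetherianRing A]
    [IsIntegrallyClosed A] {K : Type*} [Field K] [Algebra A K] [IsFractionRing A K] {x : K}
    (hx : x ∉ (algebraMap A K).range) :
    ∃ (q : Ideal A) (_ : q.IsPrime) (r u : A), r ∈ q ∧ r ≠ 0 ∧ u ∉ q ∧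
      (∀ r' ∈ q, ∃ u', u * r' = u' * r) ∧
      ∀ w, algebraMap A K w * x ∈ (algebraMap A K).range → w ∈ q := by
  obtain ⟨a, b, hb, rfl⟩ := IsFractionRing.div_surjective (A := A) x
  have hbK : algebraMap A K b ≠ 0 := IsFractionRing.to_map_ne_zero_of_mem_nonZeroDivisors hb
  have hmk (a : A) : (Ideal.Quotient.mk (Ideal.span {b}) a) = 0 ↔ b ∣ a := by
    rw [Ideal.Quotient.eq_zero_iff_mem, Ideal.mem_span_singleton]
  have hdvd (a : A) : b ∣ a ↔ algebraMap A K a / algebraMap A K b ∈ (algebraMap A K).range := by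
    constructor
    · rintro ⟨c, rfl⟩
      exact ⟨c, by rw [map_mul, mul_div_cancel_left₀ _ hbK]⟩
    · rintro ⟨c, hc⟩
      refine ⟨c, IsFractionRing.injective A K ?_⟩
      rw [map_mul, hc, mul_div_cancel₀ _ hbK]
  have ha0 : (Ideal.Quotient.mk (Ideal.span {b}) a) ≠ 0 := by
    rw [Ne, hmk, hdvd]; exact hx
  obtain ⟨q, hq, hle⟩ := exists_le_isAssociatedPrime_of_isNoetherianRing A
    (Ideal.Quotient.mk (Ideal.span {b}) a) ha0
  obtain ⟨hqp, c', hc'⟩ := isAssociatedPrime_iff.mp hq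
  obtain ⟨c, rfl⟩ := Ideal.Quotient.mk_surjective c'
  have hsmul (r a : A) : r • Ideal.Quotient.mk (Ideal.span {b}) a
      = Ideal.Quotient.mk (Ideal.span {b}) (r * a) := rfl
  have hmem (r : A) : r ∈ q ↔ b ∣ r * c := by
    rw [hc', Submodule.mem_colon_singleton, Submodule.mem_bot, hsmul, hmk]
  have hcb : ¬ b ∣ c := fun h => hqp.ne_top <| by
    rw [Ideal.eq_top_iff_one, hmem, one_mul]; exact h
  -- The associated prime is `q = (b : c)`, so `z = c / b` satisfies `z q ⊆ A` but `z ∉ A`.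
  let z : K := algebraMap A K c / algebraMap A K b
  have hz0 : z ≠ 0 := fun h => hcb <| (hdvd c).mpr <| by
    change z ∈ _
    rw [h]; exact zero_mem _
  have hzq (r : A) (hr : r ∈ q) : ∃ u, algebraMap A K u = algebraMap A K r * z := by
    obtain ⟨u, hu⟩ := (hdvd _).mp ((hmem r).mp hr)
    exact ⟨u, by rw [hu, map_mul, mul_div_assoc]⟩
  have hbq : b ∈ q := (hmem b).mpr (dvd_mul_right b c)
  -- If `z q ⊆ q`, then `z` would be integral over `A`, hence in `A`. So some `u = r z` lies outside
  -- `q`, and `r` generates `q` locally.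
  obtain ⟨r, hr, u, hu, huq⟩ : ∃ r ∈ q, ∃ u, algebraMap A K u = algebraMap A K r * z ∧ u ∉ q := by
    by_contra! hcon
    have hint : IsIntegral A z := by
      refine isIntegral_of_smul_mem_submodule (Submodule.map (Algebra.linearMap A K) q) ?_
        (Submodule.FG.map _ (IsNoetherian.noetherian q)) z ?_
      · rw [Submodule.ne_bot_iff]
        exact ⟨_, ⟨b, hbq, rfl⟩, hbK⟩
      · rintro _ ⟨r, hr, rfl⟩
        obtain ⟨u, hu⟩ := hzq r hr
        exact ⟨u, hcon r hr u hu, by rw [Algebra.linearMap_apply, hu, mul_comm]; rfl⟩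
    obtain ⟨y, hy⟩ := IsIntegrallyClosed.algebraMap_eq_of_integral hint
    exact hcb ((hdvd c).mpr ⟨y, hy⟩)
  refine ⟨q, hqp, r, u, hr, ?_, huq, fun r' hr' => ?_, fun w hw => hle ?_⟩
  · rintro rfl
    rw [map_zero, zero_mul, map_eq_zero_iff _ (IsFractionRing.injective A K)] at hu
    exact huq (hu ▸ q.zero_mem)
  · obtain ⟨u', hu'⟩ := hzq r' hr'
    refine ⟨u', IsFractionRing.injective A K ?_⟩
    rw [map_mul, map_mul, hu, hu']
    ring
  · rw [Submodule.mem_colon_singleton, Submodule.mem_bot, hsmul, hmk, hdvd, map_mul,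
      mul_div_assoc]
    exact hw

/-- A value outside `A` would be detected at a prime `q` with `A_q` a discrete valuation ring. There
a `p`-basis of `A_q` exists and makes the value integral, and the value is the same for every
`p`-basis. -/
theorem fieldSplit_mem_range {A : Type*} [CommRing A] [IsDomain A] [IsNoetherianRing A]
    [IsIntegrallyClosed A] (hA : IsFFinite p A) [CharP (FractionRing A) p]
    {s : A → A} (hs : IsFrobDelta p fun a => algebraMap A (FractionRing A) (s a))
    {n : ℕ} {x : Fin n → A} (hx : IsPBasis p (fun i => algebraMap A (FractionRing A) (x i)))
    (g : A) :
    fieldSplit (fun a => algebraMap A (FractionRing A) (s a)) hx (algebraMap _ _ g)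
      ∈ (algebraMap A (FractionRing A)).range := by
  let K := FractionRing A
  by_contra hcon
  obtain ⟨q, hq, r, u, hrq, hr0, huq, hdiv, hmem⟩ := exists_prime_of_notMem_range hcon
  let R := Localization.AtPrime q
  have hle := q.primeCompl_le_nonZeroDivisors
  have : IsFractionRing R K :=
    IsFractionRing.isFractionRing_of_isDomain_of_isLocalization q.primeCompl R K
  have : IsDomain R := IsLocalization.isDomain_localization hle
  have : IsNoetherianRing R := IsLocalization.isNoetherianRing q.primeCompl R inferInstance
  have hpA : ((p : ℕ) : A) = 0 := by
    apply IsFractionRing.injective A K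
    rw [map_natCast, map_zero, CharP.cast_eq_zero]
  have hpR : ((p : ℕ) : R) = 0 := by rw [← map_natCast (algebraMap A R), hpA, map_zero]
  have : CharP R p := (CharP.charP_iff_prime_eq_zero hp.out).mpr hpR
  have : CharP (IsLocalRing.ResidueField R) p := (CharP.charP_iff_prime_eq_zero hp.out).mpr (by
    rw [← map_natCast (IsLocalRing.residue R), hpR, map_zero])
  have hRf : IsFFinite p R := hA.of_isLocalization q.primeCompl
  obtain ⟨m, y', hy'⟩ := (hRf.of_surjective (IsLocalRing.residue R)
    IsLocalRing.residue_surjective).exists_isPBasis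
  choose y hy using fun i => IsLocalRing.residue_surjective (y' i)
  have ht : IsLocalRing.maximalIdeal R = Ideal.span {algebraMap A R r} := by
    rw [← IsLocalization.AtPrime.map_eq_maximalIdeal q R]
    apply le_antisymm
    · refine Ideal.map_le_iff_le_comap.mpr fun r' hr' => ?_
      obtain ⟨u', hu'⟩ := hdiv r' hr'
      have hunit : IsUnit (algebraMap A R u) :=
        IsLocalization.map_units R (⟨u, huq⟩ : q.primeCompl)
      rw [Ideal.mem_comap, Ideal.mem_span_singleton, ← hunit.dvd_mul_left, ← map_mul, hu', map_mul]
      exact dvd_mul_left _ _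
    · rw [Ideal.span_singleton_le_iff_mem]
      exact Ideal.mem_map_of_mem _ hrq
  have ht0 : algebraMap A R r ≠ 0 := by
    rw [Ne, map_eq_zero_iff _ (IsLocalization.injective R hle)]
    exact hr0
  have hbasis := isPBasis_cons (x := y) ht ht0 hRf (by simp only [hy]; exact hy')
  obtain ⟨z, hz⟩ := hbasis.exists_isPBasis_algebraMap q.primeCompl
  have hz' : IsPBasis p (fun i => algebraMap A K (z i)) := by
    simp only [IsScalarTower.algebraMap_apply A R K]
    exact hz.toFractionField
  have hmemR (a : A) : algebraMap A K a ∈ (algebraMap R K).range :=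
    ⟨algebraMap A R a, (IsScalarTower.algebraMap_apply A R K a).symm⟩
  have hsplit := fieldSplit_mem (s := fun a => algebraMap A K (s a)) hz'
    (S := (algebraMap R K).range) (fun i => hmemR _) (fun i => hmemR _) (by
      rintro _ ⟨a, rfl⟩ e
      have := hz.coeff_algebraMap_mem_range (K := K) a e
      convert this using 1
      congr! 3
      exact IsScalarTower.algebraMap_apply A R K _) (hmemR g)
  rw [← fieldSplit_eq hs hx hz'] at hsplit
  obtain ⟨a', ha'⟩ := hsplit
  obtain ⟨a, w, rfl⟩ := IsLocalization.exists_mk'_eq q.primeCompl a'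
  refine w.2 (hmem w ⟨a, ?_⟩)
  rw [← ha', IsScalarTower.algebraMap_apply A R K w, ← map_mul, IsLocalization.mk'_spec',
    ← IsScalarTower.algebraMap_apply]

/-- `φ` is the restriction to `A` of the splitting of the fraction field given by `s`. -/
def IsSplit (p : ℕ) [Fact p.Prime] {A : Type*} [CommRing A] [IsDomain A]
    [CharP (FractionRing A) p] (s : A → A) (φ : A → A) : Prop :=
  ∀ (n : ℕ) (x : Fin n → A) (hx : IsPBasis p (fun i => algebraMap A (FractionRing A) (x i)))
    (g : A), algebraMap A (FractionRing A) (φ g)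
      = fieldSplit (fun a => algebraMap A (FractionRing A) (s a)) hx (algebraMap _ _ g)

theorem exists_isPBasis_fractionRing {A : Type*} [CommRing A] [IsDomain A] (hA : IsFFinite p A)
    [CharP (FractionRing A) p] :
    ∃ (n : ℕ) (x : Fin n → A), IsPBasis p (fun i => algebraMap A (FractionRing A) (x i)) := by
  obtain ⟨n, x, hx⟩ := (hA.of_isLocalization (S := FractionRing A)
    (nonZeroDivisors A)).exists_isPBasis
  exact ⟨n, hx.exists_isPBasis_algebraMap (nonZeroDivisors A)⟩

section Split

variable {A : Type*} [CommRing A] [IsDomain A] [CharP (FractionRing A) p] {s φ : A → A}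

theorem exists_isSplit [IsNoetherianRing A] [IsIntegrallyClosed A] (hA : IsFFinite p A)
    (hs : IsFrobDelta p fun a => algebraMap A (FractionRing A) (s a)) :
    ∃ φ : A → A, IsSplit p s φ := by
  obtain ⟨n, x, hx⟩ := exists_isPBasis_fractionRing (p := p) hA
  choose φ hφ using fieldSplit_mem_range hA hs hx
  exact ⟨φ, fun m y hy g => (hφ g).trans (fieldSplit_eq hs hx hy _)⟩

namespace IsSplit

theorem map_add (h : IsSplit p s φ) (hA : IsFFinite p A) (a b : A) : φ (a + b) = φ a + φ b := by
  obtain ⟨n, x, hx⟩ := exists_isPBasis_fractionRing (p := p) hA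
  apply IsFractionRing.injective A (FractionRing A)
  simp only [_root_.map_add, h n x hx]

theorem map_pow_mul (h : IsSplit p s φ) (hA : IsFFinite p A) (a b : A) :
    φ (a ^ p * b) = a * φ b := by
  obtain ⟨n, x, hx⟩ := exists_isPBasis_fractionRing (p := p) hA
  apply IsFractionRing.injective A (FractionRing A)
  rw [h n x hx, map_mul (algebraMap A (FractionRing A)), map_pow, fieldSplit_pow_mul,
    map_mul (algebraMap A (FractionRing A)), h n x hx]

theorem map_one (h : IsSplit p s φ) (hA : IsFFinite p A) : φ 1 = 1 := by
  obtain ⟨n, x, hx⟩ := exists_isPBasis_fractionRing (p := p) hA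
  apply IsFractionRing.injective A (FractionRing A)
  rw [h n x hx, _root_.map_one, fieldSplit_one]

end IsSplit
end Split

/-! ### Compatibility with field maps and birational extensions -/

section Transport

variable {K L : Type*} [Field K] [CharP K p] [Field L] [CharP L p] {ι : Type*} [Fintype ι]
  [DecidableEq ι] {x : ι → K} {y : ι → L} (f : K →+* L) (hxy : ∀ i, f (x i) = y i)

include hxy in
theorem map_pmon (e : ι → ZMod p) : f (pmon p x e) = pmon p y e := by
  simp [pmon, hxy]

include hxy in
theorem IsPBasis.map_of_surjective (hf : Function.Surjective f) (hx : IsPBasis p x) :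
    IsPBasis p y := by
  obtain ⟨h1, h2⟩ := isPBasis_iff.mp hx
  refine isPBasis_iff.mpr ⟨fun c hc => ?_, fun a => ?_⟩
  · choose d hd using fun e => hf (c e)
    have := h1 d (f.injective (by
      rw [map_zero, ← hc, map_sum]
      exact Finset.sum_congr rfl fun e _ => by rw [map_mul, map_pow, hd, map_pmon f hxy]))
    funext e
    rw [← hd, this, Pi.zero_apply, map_zero, Pi.zero_apply]
  · obtain ⟨a, rfl⟩ := hf a
    obtain ⟨c, rfl⟩ := h2 a
    refine ⟨fun e => f (c e), ?_⟩
    rw [map_sum]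
    exact Finset.sum_congr rfl fun e _ => by rw [map_mul, map_pow, map_pmon f hxy]

include hxy in
theorem IsPBasis.coeff_map (hx : IsPBasis p x) (hy : IsPBasis p y) (e : ι → ZMod p) (a : K) :
    hy.coeff e (f a) = f (hx.coeff e a) := by
  have : hy.repr (f a) = fun e => f (hx.repr a e) := by
    apply hy.repr_eq
    conv_rhs => rw [← hx.sum_repr a, map_sum]
    exact Finset.sum_congr rfl fun e _ => by rw [map_mul, map_pow, map_pmon f hxy]
  exact congrFun this e

include hxy in
theorem IsPBasis.theta_map (hx : IsPBasis p x) (hy : IsPBasis p y) (j : ι) (a : K) :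
    hy.theta j (f a) = f (hx.theta j a) := by
  have hc (z : ZMod p) : f (primeCast p K z) = primeCast p L z :=
    RingHom.congr_fun (Subsingleton.elim (f.comp (primeCast p K)) (primeCast p L)) z
  simp only [theta_apply, proj_apply, map_sum, map_mul, map_pow, hc, map_pmon f hxy,
    hx.coeff_map f hxy hy]

end Transport

/-- Coefficients and `θⱼ` commute with `f`, and the discrepancy between `t` and `s` is a `p`-th
power, invisible to derivations. -/
theorem fieldSplit_map {A B K L : Type*} [CommRing A] [CommRing B] [Field K] [CharP K p] [Field L]
    [CharP L p] [Algebra A K] [Algebra B L] {ι : Type*} [Fintype ι] [DecidableEq ι] (ρ : A →+* B)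
    (f : K →+* L) (hf : ∀ a, f (algebraMap A K a) = algebraMap B L (ρ a)) {s : A → K} {t : B → L}
    (hst : ∀ a, ∃ c, t (ρ a) = f (s a) + c ^ p) {x : ι → A}
    (hx : IsPBasis p (fun i => algebraMap A K (x i)))
    (hy : IsPBasis p (fun i => algebraMap B L (ρ (x i)))) (g : K) :
    fieldSplit (x := fun i => ρ (x i)) t hy (f g) = f (fieldSplit s hx g) := by
  have hdet : frobDet (x := fun i => ρ (x i)) t hy = f (frobDet s hx) := by
    rw [frobDet, frobDet, RingHom.map_det, map_add, map_one]
    congr 2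
    ext i j
    obtain ⟨c, hc⟩ := hst (x i)
    rw [Matrix.of_apply, RingHom.mapMatrix_apply, Matrix.map_apply, Matrix.of_apply,
      theta_div_pow, theta_div_pow, hc, map_add, derivation_pow_char, add_zero,
      hx.theta_map f (fun i => hf _) hy, map_div₀, map_pow, hf]
  rw [fieldSplit_apply, fieldSplit_apply, hdet, ← map_mul, hx.coeff_map f (fun i => hf _) hy]

/-- The splittings are compatible with birational extensions. -/
theorem IsSplit.comp_eq {A B : Type*} [CommRing A] [IsDomain A] [CharP (FractionRing A) p]
    [CommRing B] [IsDomain B] [CharP (FractionRing B) p] {s φ : A → A} {t ψ : B → B}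
    (hA : IsFFinite p A) (hφ : IsSplit p s φ) (hψ : IsSplit p t ψ) (ρ : A →+* B)
    (hρ : Function.Injective ρ) (hfrac : ∀ b, ∃ a a', a' ≠ 0 ∧ ρ a' * b = ρ a)
    (hst : ∀ a, ∃ c, t (ρ a) = ρ (s a) + c ^ p) (g : A) : ψ (ρ g) = ρ (φ g) := by
  let f : FractionRing A →+* FractionRing B := IsFractionRing.map hρ
  have hf (a : A) : f (algebraMap A (FractionRing A) a) = algebraMap B (FractionRing B) (ρ a) :=
    IsLocalization.map_eq _ a
  have hB (b : B) : ∃ a, f a = algebraMap B (FractionRing B) b := by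
    obtain ⟨a, a', ha', hb⟩ := hfrac b
    have h0 : algebraMap B (FractionRing B) (ρ a') ≠ 0 := by
      rw [Ne, map_eq_zero_iff _ (IsFractionRing.injective B (FractionRing B)),
        map_eq_zero_iff ρ hρ]
      exact ha'
    refine ⟨algebraMap A _ a / algebraMap A _ a', ?_⟩
    rw [map_div₀, hf, hf, ← hb, map_mul, mul_div_cancel_left₀ _ h0]
  have hsurj : Function.Surjective f := fun y => by
    obtain ⟨a, b, -, rfl⟩ := IsFractionRing.div_surjective (A := B) y
    obtain ⟨a, ha⟩ := hB a
    obtain ⟨b, hb⟩ := hB b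
    exact ⟨a / b, by rw [map_div₀, ha, hb]⟩
  obtain ⟨n, x, hx⟩ := exists_isPBasis_fractionRing (p := p) hA
  have hy : IsPBasis p (fun i => algebraMap B (FractionRing B) (ρ (x i))) :=
    hx.map_of_surjective f (fun i => hf _) hsurj
  apply IsFractionRing.injective B (FractionRing B)
  rw [hψ n (fun i => ρ (x i)) hy, ← hf g, ← hf (φ g), hφ n x hx]
  refine fieldSplit_map ρ f hf (fun a => ?_) hx hy _
  obtain ⟨c, hc⟩ := hst a
  exact ⟨algebraMap B _ c, by rw [hc, _root_.map_add, map_pow, hf]⟩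

end

section
variable {p : ℕ} [hp : Fact p.Prime]

/-! ### Liftings of Frobenius modulo `p²` -/

/-- The polynomial `((x + y) ^ p - x ^ p - y ^ p) / p`. -/
def frobCarry (p : ℕ) {R : Type*} [CommRing R] (x y : R) : R :=
  ∑ j ∈ Finset.range (p - 1), ((p.choose (j + 1) / p : ℕ) : R) * (x ^ (j + 1) * y ^ (p - (j + 1)))

theorem choose_succ_div (j : ℕ) (hj : j ∈ Finset.range (p - 1)) :
    p * (p.choose (j + 1) / p) = p.choose (j + 1) := by
  have := Finset.mem_range.mp hj
  exact Nat.mul_div_cancel' (hp.out.dvd_choose_self (by omega) (by omega))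

theorem choose_succ_div_mul (j : ℕ) (hj : j ∈ Finset.range (p - 1)) :
    p.choose (j + 1) / p * (j + 1) = (p - 1).choose j := by
  have h := Nat.add_one_mul_choose_eq (p - 1) j
  rw [Nat.sub_add_cancel hp.out.one_le, ← choose_succ_div j hj, mul_assoc] at h
  exact (Nat.eq_of_mul_eq_mul_left hp.out.pos h).symm

theorem add_pow_eq_frobCarry {R : Type*} [CommRing R] (x y : R) :
    (x + y) ^ p = x ^ p + y ^ p + p * frobCarry p x y := by
  have hp1 : p - 1 + 1 = p := Nat.sub_add_cancel hp.out.one_le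
  rw [add_pow, Finset.sum_range_succ, ← hp1, Finset.sum_range_succ', hp1, frobCarry,
    Finset.mul_sum]
  have : ∑ j ∈ Finset.range (p - 1), x ^ (j + 1) * y ^ (p - (j + 1)) * (p.choose (j + 1) : R)
      = ∑ j ∈ Finset.range (p - 1), (p : R) * (((p.choose (j + 1) / p : ℕ) : R)
        * (x ^ (j + 1) * y ^ (p - (j + 1)))) := by
    refine Finset.sum_congr rfl fun j hj => ?_
    rw [← mul_assoc, ← Nat.cast_mul, choose_succ_div j hj, mul_comm]
  rw [this]
  simp
  ring

theorem sum_choose_div {R : Type*} [CommRing R] (x y : R) :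
    ∑ j ∈ Finset.range (p - 1), ((p.choose (j + 1) / p : ℕ) : R) * ((j + 1 : ℕ) : R)
      * (x ^ j * y ^ (p - (j + 1))) = (x + y) ^ (p - 1) - x ^ (p - 1) := by
  rw [add_pow, Finset.sum_range_succ]
  simp only [Nat.choose_self, Nat.sub_self, pow_zero, Nat.cast_one, mul_one, add_sub_cancel_right]
  refine Finset.sum_congr rfl fun j hj => ?_
  rw [← Nat.cast_mul, choose_succ_div_mul j hj, Nat.sub_add_eq, Nat.sub_right_comm, mul_comm]

theorem sum_choose_div' {R : Type*} [CommRing R] (x y : R) :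
    ∑ j ∈ Finset.range (p - 1), ((p.choose (j + 1) / p : ℕ) : R) * ((p - (j + 1) : ℕ) : R)
      * (x ^ (j + 1) * y ^ (p - (j + 1) - 1)) = (x + y) ^ (p - 1) - y ^ (p - 1) := by
  rw [add_comm, ← sum_choose_div y x, ← Finset.sum_range_reflect]
  refine Finset.sum_congr rfl fun j hj => ?_
  have hj' := Finset.mem_range.mp hj
  have e1 : p - 1 - 1 - j + 1 = p - (j + 1) := by omega
  have e2 : p - (p - (j + 1)) = j + 1 := by omega
  rw [e1, e2, Nat.choose_symm (by omega : j + 1 ≤ p), Nat.add_sub_cancel]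
  ring

/-- The formal derivative of `((x + y) ^ p - x ^ p - y ^ p) / p`. In characteristic `p` the division
by `p` must be made on the binomial coefficients. -/
theorem derivation_frobCarry {K : Type*} [Field K] (D : Derivation ℤ K K) (x y : K) :
    D (frobCarry p x y) = (x + y) ^ (p - 1) * (D x + D y) - x ^ (p - 1) * D x
      - y ^ (p - 1) * D y := by
  rw [frobCarry, map_sum]
  have (j : ℕ) : D (((p.choose (j + 1) / p : ℕ) : K) * (x ^ (j + 1) * y ^ (p - (j + 1))))
      = ((p.choose (j + 1) / p : ℕ) : K) * ((j + 1 : ℕ) : K) * (x ^ j * y ^ (p - (j + 1))) * D x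
        + ((p.choose (j + 1) / p : ℕ) : K) * ((p - (j + 1) : ℕ) : K)
          * (x ^ (j + 1) * y ^ (p - (j + 1) - 1)) * D y := by
    rw [D.leibniz, D.leibniz, D.leibniz_pow, D.leibniz_pow, D.map_natCast]
    simp only [smul_eq_mul, nsmul_eq_mul, Nat.add_sub_cancel]
    ring
  simp only [this, Finset.sum_add_distrib, ← Finset.sum_mul, sum_choose_div, sum_choose_div']
  ring

/-- A lifting of the Frobenius of `A` to a flat lifting of `A` modulo `p²`. -/
structure RingFrobLift (p : ℕ) {A' A : Type*} [CommRing A'] [CommRing A] (π : A' →+* A)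
    (F : A' →+* A') : Prop where
  surjective : Function.Surjective π
  sq_eq_zero : (p : A') ^ 2 = 0
  exists_eq : ∀ a, π a = 0 → ∃ b, a = p * b
  map_eq_zero : ∀ a, (p : A') * a = 0 → π a = 0
  map_frob : ∀ a, π (F a) = π a ^ p

namespace RingFrobLift

variable {A' A : Type*} [CommRing A'] [CommRing A] {π : A' →+* A} {F : A' →+* A'}
  (h : RingFrobLift p π F)

include h

theorem exists_delta (a : A') : ∃ d, F a = a ^ p + p * d := by
  obtain ⟨d, hd⟩ := h.exists_eq (F a - a ^ p) (by rw [map_sub, map_pow, h.map_frob, sub_self])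
  exact ⟨d, by rw [← hd]; ring⟩

/-- For `a = a' + p b` one has `a ^ p = a' ^ p` modulo `p²` and `F (p b) = p F b`, so `d` changes by
`F b`, which reduces to a `p`-th power. -/
theorem delta_unique {a a' d d' : A'} (ha : π a = π a') (hd : F a = a ^ p + p * d)
    (hd' : F a' = a' ^ p + p * d') : ∃ c, π d = π d' + c ^ p := by
  obtain ⟨b, hb⟩ := h.exists_eq (a - a') (by rw [map_sub, ha, sub_self])
  obtain rfl : a = a' + p * b := by rw [← hb]; ring
  have hpow : (a' + p * b) ^ p = a' ^ p := by
    have := dvd_sub_pow_of_dvd_sub (R := A') (p := p) (a := a' + p * b) (b := a')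
      ⟨b, by ring⟩ 1
    rw [h.sq_eq_zero, zero_dvd_iff, pow_one, sub_eq_zero] at this
    exact this
  rw [hpow, map_add, map_mul, map_natCast, hd'] at hd
  have := h.map_eq_zero (d' + F b - d) (by linear_combination hd)
  rw [map_sub, map_add, h.map_frob, sub_eq_zero] at this
  exact ⟨π b, this.symm⟩

theorem exists_section : ∃ s : A → A, ∀ a, ∃ a' d, π a' = a ∧ F a' = a' ^ p + p * d ∧ s a = π d := by
  choose l hl using h.surjective
  choose d hd using h.exists_delta
  exact ⟨fun a => π (d (l a)), fun a => ⟨l a, d (l a), hl a, hd _, rfl⟩⟩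

/-- A choice of `(F a - a ^ p) / p`. -/
def delta : A → A := h.exists_section.choose

theorem delta_spec {a' d : A'} (hd : F a' = a' ^ p + p * d) :
    ∃ c, h.delta (π a') = π d + c ^ p := by
  obtain ⟨b, e, hb, he, hs⟩ := h.exists_section.choose_spec (π a')
  obtain ⟨c, hc⟩ := h.delta_unique hb he hd
  exact ⟨c, hs.trans hc⟩

/-- `δ` fails to be additive by the carry polynomial, whose derivative is compensated by `a ^ (p -
1) Da`. Its dependence on lifts is a `p`-th power, killed by `D`. -/
theorem isFrobDelta {K : Type*} [Field K] [CharP K p] [Algebra A K] :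
    IsFrobDelta p fun a => algebraMap A K (h.delta a) := by
  have hder (D : Derivation ℤ K K) {a d : A'} (hd : F a = a ^ p + p * d) :
      frobDer p (fun a => algebraMap A K (h.delta a)) D (π a)
        = algebraMap A K (π a) ^ (p - 1) * D (algebraMap A K (π a))
          + D (algebraMap A K (π d)) := by
    obtain ⟨c, hc⟩ := h.delta_spec hd
    rw [frobDer, hc, map_add (algebraMap A K), map_pow, map_add, derivation_pow_char, add_zero]
  constructor
  · intro D a b
    obtain ⟨a, rfl⟩ := h.surjective a
    obtain ⟨b, rfl⟩ := h.surjective b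
    obtain ⟨d, hd⟩ := h.exists_delta a
    obtain ⟨e, he⟩ := h.exists_delta b
    have hde : F (a + b) = (a + b) ^ p + p * (d + e - frobCarry p a b) := by
      rw [map_add, hd, he, add_pow_eq_frobCarry]
      ring
    rw [← map_add, hder D hd, hder D he, hder D hde]
    have : algebraMap A K (π (frobCarry p a b))
        = frobCarry p (algebraMap A K (π a)) (algebraMap A K (π b)) := by
      simp [frobCarry]
    simp only [map_add, map_sub, this, derivation_frobCarry]
    ring
  · intro D a b
    obtain ⟨a, rfl⟩ := h.surjective a
    obtain ⟨b, rfl⟩ := h.surjective b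
    obtain ⟨d, hd⟩ := h.exists_delta a
    obtain ⟨e, he⟩ := h.exists_delta b
    have hde : F (a * b) = (a * b) ^ p + p * (a ^ p * e + b ^ p * d) := by
      rw [map_mul, hd, he]
      linear_combination d * e * h.sq_eq_zero
    rw [← map_mul, hder D hd, hder D he, hder D hde]
    simp only [map_add, map_mul, map_pow, Derivation.leibniz, derivation_pow_char, smul_eq_mul,
      mul_zero, add_zero]
    rw [← pow_sub_one_mul hp.out.ne_zero (algebraMap A K (π a)),
      ← pow_sub_one_mul hp.out.ne_zero (algebraMap A K (π b))]
    ring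

omit h in
/-- The functions `delta` are compatible with morphisms of liftings. -/
theorem delta_map {B' B : Type*} [CommRing B'] [CommRing B] {π' : B' →+* B} {G : B' →+* B'}
    (h : RingFrobLift p π F) (h' : RingFrobLift p π' G) (ρ' : A' →+* B') (ρ : A →+* B)
    (hπ : ∀ a, π' (ρ' a) = ρ (π a)) (hF : ∀ a, G (ρ' a) = ρ' (F a)) (a : A) [CharP B p] :
    ∃ c, h'.delta (ρ a) = ρ (h.delta a) + c ^ p := by
  obtain ⟨a, rfl⟩ := h.surjective a
  obtain ⟨d, hd⟩ := h.exists_delta a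
  obtain ⟨c, hc⟩ := h.delta_spec hd
  obtain ⟨c', hc'⟩ := h'.delta_spec (a' := ρ' a) (d := ρ' d) (by
    rw [hF, hd, map_add, map_mul, map_pow, map_natCast])
  refine ⟨c' - ρ c, ?_⟩
  rw [← hπ, hc', hc, map_add, map_pow, sub_pow_char, hπ]
  ring

end RingFrobLift

end

section
variable {p : ℕ} [hp : Fact p.Prime]

/-! ### Frobenius splittings from local data -/

/-- Restriction of sections. -/
def resHom {X : Scheme.{u}} {U V : X.Opens} (h : V ≤ U) : Γ(X, U) →+* Γ(X, V) :=
  (X.presheaf.map (homOfLE h).op).hom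

theorem resHom_resHom {X : Scheme.{u}} {U V W : X.Opens} (h : V ≤ U) (h' : W ≤ V)
    (a : Γ(X, U)) : resHom h' (resHom h a) = resHom (h'.trans h) a := by
  simp only [resHom, ← CommRingCat.comp_apply, ← Functor.map_comp, ← op_comp, homOfLE_comp]

/-- A compatible family of `p⁻¹`-linear maps on sections is a Frobenius splitting. -/
theorem isFrobeniusSplit_of_family {X : Scheme.{u}} (hX : IsCharPScheme p X)
    (φ : ∀ U : X.Opens, Γ(X, U) → Γ(X, U)) (hadd : ∀ U a b, φ U (a + b) = φ U a + φ U b)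
    (hmul : ∀ U a b, φ U (a ^ p * b) = a * φ U b) (hone : ∀ U, φ U 1 = 1)
    (hres : ∀ (U V : X.Opens) (h : V ≤ U) a, φ V (resHom h a) = resHom h (φ U a)) :
    IsFrobeniusSplit p X := by
  have hpow (U : X.Opens) (a : Γ(X, U)) : φ U (a ^ p) = a := by
    have := hmul U a 1
    rwa [mul_one, hone, mul_one] at this
  refine ⟨hX, ⟨PresheafOfModules.homMk
    { app := fun U => AddCommGrpCat.ofHom (AddMonoidHom.mk' (φ U.unop) (hadd U.unop))
      naturality := fun U V i => ?_ } ?_⟩, ?_⟩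
  · ext a
    exact hres U.unop V.unop i.unop.le a
  · intro U a b
    exact hmul U.unop a b
  · refine Scheme.Modules.hom_ext _ _ fun U => ?_
    ext a
    exact hpow U a

section Basis

variable {X : Scheme.{u}} {ι : Type*} {W : ι → X.Opens}
  (hW : ∀ (U : X.Opens), ∀ x ∈ U, ∃ i, x ∈ W i ∧ W i ≤ U)

include hW

theorem eq_of_res_eq {U : X.Opens} {a b : Γ(X, U)}
    (h : ∀ i (hi : W i ≤ U), resHom hi a = resHom hi b) : a = b := by
  refine X.sheaf.eq_of_locally_eq' (fun i : {i // W i ≤ U} => W i) U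
    (fun i => homOfLE i.2) (fun x hx => ?_) a b fun i => h i i.2
  obtain ⟨i, hxi, hi⟩ := hW U x hx
  exact TopologicalSpace.Opens.mem_iSup.mpr ⟨⟨i, hi⟩, hxi⟩

theorem existsUnique_of_basis (φ : ∀ i, Γ(X, W i) → Γ(X, W i))
    (hres : ∀ i j (h : W j ≤ W i) a, φ j (resHom h a) = resHom h (φ i a)) (U : X.Opens)
    (a : Γ(X, U)) : ∃! b : Γ(X, U), ∀ i (hi : W i ≤ U), resHom hi b = φ i (resHom hi a) := by
  obtain ⟨b, hb, -⟩ := X.sheaf.existsUnique_gluing' (fun i : {i // W i ≤ U} => W i) U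
    (fun i => homOfLE i.2) (fun x hx => by
      obtain ⟨i, hxi, hi⟩ := hW U x hx
      exact TopologicalSpace.Opens.mem_iSup.mpr ⟨⟨i, hi⟩, hxi⟩)
    (fun i => φ i (resHom i.2 a)) (fun i j => eq_of_res_eq hW fun k hk => by
      change resHom hk (resHom inf_le_left _) = resHom hk (resHom inf_le_right _)
      rw [resHom_resHom, resHom_resHom, ← hres _ _ (hk.trans inf_le_left),
        ← hres _ _ (hk.trans inf_le_right), resHom_resHom, resHom_resHom])
  refine ⟨b, fun i hi => hb ⟨i, hi⟩, fun c hc => eq_of_res_eq hW fun i hi => ?_⟩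
  rw [hc i hi]
  exact (hb ⟨i, hi⟩).symm

/-- Frobenius splittings can be glued from the members of a basis of the topology. -/
theorem isFrobeniusSplit_of_basis (hX : IsCharPScheme p X) (φ : ∀ i, Γ(X, W i) → Γ(X, W i))
    (hadd : ∀ i a b, φ i (a + b) = φ i a + φ i b)
    (hmul : ∀ i a b, φ i (a ^ p * b) = a * φ i b) (hone : ∀ i, φ i 1 = 1)
    (hres : ∀ i j (h : W j ≤ W i) a, φ j (resHom h a) = resHom h (φ i a)) :
    IsFrobeniusSplit p X := by
  choose ψ hψ _ using existsUnique_of_basis hW φ hres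
  dsimp only at hψ
  refine isFrobeniusSplit_of_family hX ψ (fun U a b => ?_) (fun U a b => ?_) (fun U => ?_)
    fun U V h a => ?_
  all_goals refine eq_of_res_eq hW fun i hi => ?_
  · simp only [hψ, map_add, hadd]
  · simp only [hψ, map_mul, map_pow, hmul]
  · simp only [hψ, map_one, hone]
  · rw [hψ, resHom_resHom, resHom_resHom, hψ]

end Basis

/-! ### Rings of functions of a lifting -/

section Witt

variable (p) (k : Type u) [Field k] [CharP k p] [PerfectField k]

theorem W2.coeff_mul_zero (x : WittVector p k) :
    ((p : W2 p k) * WittVector.truncate 2 x).coeff 0 = 0 := by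
  rw [← map_natCast (WittVector.truncate 2), ← map_mul, mul_comm, WittVector.coeff_truncate]
  exact WittVector.mul_charP_coeff_zero x

theorem W2.coeff_mul_one (x : WittVector p k) :
    ((p : W2 p k) * WittVector.truncate 2 x).coeff 1 = x.coeff 0 ^ p := by
  rw [← map_natCast (WittVector.truncate 2), ← map_mul, mul_comm, WittVector.coeff_truncate]
  exact WittVector.mul_charP_coeff_succ x 0

theorem W2.residue_eq_zero_of_mul_eq_zero {a : W2 p k} (ha : (p : W2 p k) * a = 0) :
    W2.residue p k a = 0 := by
  obtain ⟨x, rfl⟩ := WittVector.truncate_surjective p 2 k a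
  have h := W2.coeff_mul_one p k x
  rw [ha, TruncatedWittVector.coeff_zero, eq_comm,
    pow_eq_zero_iff (Fact.out : p.Prime).ne_zero] at h
  rw [W2.residue_apply, WittVector.coeff_truncate]
  exact h

theorem W2.exists_eq_mul_of_residue_eq_zero {a : W2 p k} (ha : W2.residue p k a = 0) :
    ∃ b, a = p * b := by
  have : PerfectRing k p := PerfectField.toPerfectRing p
  -- Since `p * (c, _) = (0, c ^ p)`, dividing by `p` takes a `p`-th root in `k`.
  obtain ⟨c, hc⟩ := (bijective_frobenius k p).2 (a.coeff 1)
  refine ⟨WittVector.truncate 2 (WittVector.mk p fun _ => c), ?_⟩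
  rw [W2.residue_apply] at ha
  ext i
  fin_cases i
  · exact ha.trans (W2.coeff_mul_zero p k _).symm
  · exact hc.symm.trans (W2.coeff_mul_one p k (WittVector.mk p fun _ => c)).symm

theorem W2.sq_eq_zero : ((p : ℕ) : W2 p k) ^ 2 = 0 := by
  rw [sq]
  ext i
  have h1 := W2.coeff_mul_zero p k (p : WittVector p k)
  have h2 := W2.coeff_mul_one p k (p : WittVector p k)
  rw [map_natCast] at h1 h2
  fin_cases i
  · exact h1.trans (TruncatedWittVector.coeff_zero p 2 k 0).symm
  · refine h2.trans ?_
    have h3 := WittVector.mul_charP_coeff_zero (p := p) (1 : WittVector p k)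
    rw [one_mul] at h3
    rw [h3, zero_pow (Fact.out : p.Prime).ne_zero]
    exact (TruncatedWittVector.coeff_zero p 2 k 1).symm

theorem W2.residue_surjective : Function.Surjective (W2.residue p k) := fun a => by
  refine ⟨WittVector.truncate 2 (WittVector.teichmuller p a), ?_⟩
  rw [W2.residue_apply, WittVector.coeff_truncate]
  exact WittVector.teichmuller_coeff_zero p a

end Witt
end

section
variable {p : ℕ} [hp : Fact p.Prime]

/-! ### Affine opens of a lifting -/

/-- If the annihilator of `s` in `S` lies in `sS`, the equational criterion of flatness carries this
over to `R`. It is used for `s = p` over `W₂(k)`. -/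
theorem exists_eq_mul_of_flat {S R : Type*} [CommRing S] [CommRing R] [Algebra S R]
    [Module.Flat S R] {s : S} (hS : ∀ a : S, s * a = 0 → ∃ b, a = s * b) {a : R}
    (ha : algebraMap S R s * a = 0) : ∃ b, a = algebraMap S R s * b := by
  obtain ⟨κ, c, y, hay, hc⟩ := Module.Flat.isTrivialRelation_of_sum_smul_eq_zero
    (R := S) (M := R) (ι := Unit) (f := fun _ => s) (x := fun _ => a)
    (by simpa [Algebra.smul_def] using ha)
  choose b hb using fun j => hS (c () j) (by simpa using hc j)
  refine ⟨∑ j, algebraMap S R (b j) * y j, ?_⟩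
  refine (hay ()).trans ?_
  rw [Finset.mul_sum]
  exact Finset.sum_congr rfl fun j _ => by rw [Algebra.smul_def, hb, map_mul, mul_assoc]

/-- The kernel of the projection of a pushout of rings along a surjection. -/
theorem exists_eq_mul_of_isPushout {S R k A : CommRingCat.{u}} {w : S ⟶ R} {r : S ⟶ k}
    {π : R ⟶ A} {κ : k ⟶ A} (h : IsPushout w r π κ) (hr : Function.Surjective r) {s : S}
    (hs : ∀ a, r a = 0 → ∃ b, a = s * b) {a : R} (ha : π a = 0) : ∃ b, a = w s * b := by
  let q : R ⟶ CommRingCat.of (R ⧸ Ideal.span {w s}) :=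
    CommRingCat.ofHom (Ideal.Quotient.mk (Ideal.span {w s}))
  have hq (a : S) (ha : a ∈ RingHom.ker r.hom) : (w ≫ q).hom a = 0 := by
    obtain ⟨b, rfl⟩ := hs a ha
    change Ideal.Quotient.mk _ (w.hom (s * b)) = 0
    rw [Ideal.Quotient.eq_zero_iff_mem, map_mul]
    exact Ideal.mul_mem_right _ _ (Ideal.mem_span_singleton_self _)
  let l : k ⟶ CommRingCat.of (R ⧸ Ideal.span {w s}) := CommRingCat.ofHom
    (RingHom.liftOfRightInverse r.hom (Function.surjInv hr) (Function.rightInverse_surjInv hr)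
      ⟨(w ≫ q).hom, hq⟩)
  have hl : w ≫ q = r ≫ l := by
    ext a
    exact (RingHom.liftOfRightInverse_comp_apply r.hom _ (Function.rightInverse_surjInv hr)
      ⟨(w ≫ q).hom, hq⟩ a).symm
  have hd : (π ≫ h.desc q l hl) a = q a := by rw [h.inl_desc]
  rw [CommRingCat.comp_apply, ha, map_zero] at hd
  have hm : a ∈ Ideal.span {w s} := Ideal.Quotient.eq_zero_iff_mem.mp hd.symm
  obtain ⟨b, hb⟩ := Ideal.mem_span_singleton.mp hm
  exact ⟨b, hb⟩

section Lifting

variable {k : Type u} [Field k] [CharP k p] [PerfectField k] {X : Scheme.{u}}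
  {f : X ⟶ Spec (.of k)}

instance isClosedImmersion_specResidue : IsClosedImmersion (specResidue p k) :=
  IsClosedImmersion.spec_of_surjective _ (W2.residue_surjective p k)

instance surjective_specResidue : Surjective (specResidue p k) := by
  refine ⟨fun y => ?_⟩
  have h : y ∈ Set.range (PrimeSpectrum.comap (W2.residue p k)) := by
    rw [range_comap_of_surjective _ _ (W2.residue_surjective p k)]
    intro a ha
    obtain ⟨b, rfl⟩ := W2.exists_eq_mul_of_residue_eq_zero p k ha
    refine (PrimeSpectrum.isPrime y).mem_of_pow_mem 2 ?_
    rw [mul_pow, W2.sq_eq_zero, zero_mul]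
    exact zero_mem _
  exact h

namespace W2Lifting

variable (L : W2Lifting p f)

instance isClosedImmersion_incl : IsClosedImmersion L.incl :=
  MorphismProperty.of_isPullback L.isPullback.flip inferInstance

instance surjective_incl : Surjective L.incl :=
  MorphismProperty.of_isPullback L.isPullback.flip inferInstance

theorem le_of_preimage_le {W W' : L.total.Opens} (h : L.incl ⁻¹ᵁ W ≤ L.incl ⁻¹ᵁ W') : W ≤ W' := by
  intro y hy
  obtain ⟨x, rfl⟩ := L.incl.surjective y
  exact h hy

theorem isAffineOpen_preimage {W : L.total.Opens} (hW : IsAffineOpen W) :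
    IsAffineOpen (L.incl ⁻¹ᵁ W) := hW.preimage L.incl

theorem isPushout {W : L.total.Opens} (hW : IsAffineOpen W) :
    IsPushout (L.toBase.appLE ⊤ W le_top) ((specResidue p k).appLE ⊤ ⊤ le_top)
      (L.incl.app W) (f.appLE ⊤ (L.incl ⁻¹ᵁ W) le_top) := by
  have := (isIso_pushoutSection_iff L.isPullback (US := ⊤) (UT := ⊤) (UX := W)
    (UY := L.incl ⁻¹ᵁ W) le_top le_top (by simp)).mp
    (isIso_pushoutSection_of_isAffineOpen _ _ _ _ (isAffineOpen_top _) (isAffineOpen_top _) hW)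
  rwa [Scheme.Hom.appLE_eq_app] at this

/-- Global functions on `Spec W₂(k)`. -/
def sectionsEquiv (R : CommRingCat.{u}) : Γ(Spec R, ⊤) ≃+* R :=
  (Scheme.ΓSpecIso R).commRingCatIsoToRingEquiv

theorem sectionsEquiv_appLE (a : Γ(Spec (.of (W2 p k)), ⊤)) :
    sectionsEquiv _ ((specResidue p k).appLE ⊤ ⊤ le_top a)
      = W2.residue p k (sectionsEquiv _ a) := by
  have h := Scheme.ΓSpecIso_naturality (CommRingCat.ofHom (W2.residue p k))
  have h' : (specResidue p k).appLE ⊤ ⊤ le_top = (specResidue p k).appTop := by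
    rw [Scheme.Hom.appTop, Scheme.Hom.app_eq_appLE]
    rfl
  rw [h']
  exact ConcreteCategory.congr_hom h a

theorem exists_eq_mul_of_incl_eq_zero {W : L.total.Opens} (hW : IsAffineOpen W)
    {a : Γ(L.total, W)} (ha : L.incl.app W a = 0) : ∃ b, a = p * b := by
  have hr : Function.Surjective ((specResidue p k).appLE ⊤ ⊤ le_top) := fun c => by
    obtain ⟨d, hd⟩ := W2.residue_surjective p k (sectionsEquiv _ c)
    obtain ⟨e, rfl⟩ := (sectionsEquiv (.of (W2 p k))).surjective d
    exact ⟨e, (sectionsEquiv _).injective ((sectionsEquiv_appLE e).trans hd)⟩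
  obtain ⟨b, hb⟩ := exists_eq_mul_of_isPushout (L.isPushout hW) hr (s := (p : ℕ))
    (fun c hc => by
      obtain ⟨d, hd⟩ := W2.exists_eq_mul_of_residue_eq_zero p k (a := sectionsEquiv _ c)
        (by rw [← sectionsEquiv_appLE, hc, map_zero])
      obtain ⟨e, rfl⟩ := (sectionsEquiv (.of (W2 p k))).surjective d
      exact ⟨e, (sectionsEquiv _).injective (by rw [hd, map_mul, map_natCast])⟩) ha
  exact ⟨b, by rw [hb, map_natCast]⟩

theorem incl_eq_zero_of_mul_eq_zero {W : L.total.Opens} (hW : IsAffineOpen W)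
    {a : Γ(L.total, W)} (ha : (p : Γ(L.total, W)) * a = 0) : L.incl.app W a = 0 := by
  have hflat : (L.toBase.appLE ⊤ W le_top).hom.Flat :=
    have := L.flat
    L.toBase.flat_appLE (isAffineOpen_top _) hW _
  algebraize [(L.toBase.appLE ⊤ W le_top).hom]
  obtain ⟨b, rfl⟩ := exists_eq_mul_of_flat (S := Γ(Spec (.of (W2 p k)), ⊤)) (s := (p : ℕ))
    (fun c hc => by
      have h := W2.residue_eq_zero_of_mul_eq_zero p k (a := sectionsEquiv _ c)
        (by rw [← map_natCast (sectionsEquiv (.of (W2 p k))), ← map_mul, hc, map_zero])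
      obtain ⟨d, hd⟩ := W2.exists_eq_mul_of_residue_eq_zero p k h
      obtain ⟨e, rfl⟩ := (sectionsEquiv (.of (W2 p k))).surjective d
      exact ⟨e, (sectionsEquiv _).injective (by rw [hd, map_mul, map_natCast])⟩)
    (a := a) (by rw [map_natCast]; exact ha)
  rw [map_mul, map_natCast, map_natCast, (isCharPScheme_of_hom p f).natCast_eq_zero, zero_mul]

theorem sq_eq_zero (W : L.total.Opens) : ((p : ℕ) : Γ(L.total, W)) ^ 2 = 0 := by
  have h : ((p : ℕ) : Γ(Spec (.of (W2 p k)), ⊤)) ^ 2 = 0 :=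
    (sectionsEquiv (.of (W2 p k))).injective (by
      rw [map_pow, map_natCast, map_zero, W2.sq_eq_zero])
  have := congrArg (L.toBase.appLE ⊤ W le_top) h
  rwa [map_pow, map_natCast, map_zero] at this

end W2Lifting

namespace FrobeniusLifting

variable {L : W2Lifting p f} (G : FrobeniusLifting L)

/-- `X` and its lifting have the same points, on which the absolute Frobenius is the identity. Hence
the lifted Frobenius restricts to every open subset. -/
theorem hom_apply (y : L.total) : G.hom y = y := by
  obtain ⟨x, rfl⟩ := L.incl.surjective y
  rw [← Scheme.Hom.comp_apply, G.restrict, Scheme.Hom.comp_apply]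
  rfl

theorem le_preimage (W : L.total.Opens) : W ≤ G.hom ⁻¹ᵁ W := fun y hy => by
  change G.hom y ∈ W
  rwa [G.hom_apply]

theorem ringFrobLift {W : L.total.Opens} (hW : IsAffineOpen W) :
    RingFrobLift p (L.incl.app W).hom (G.hom.appLE W W (G.le_preimage W)).hom where
  surjective := L.incl.app_surjective W hW
  sq_eq_zero := L.sq_eq_zero W
  exists_eq _ ha := L.exists_eq_mul_of_incl_eq_zero hW ha
  map_eq_zero _ ha := L.incl_eq_zero_of_mul_eq_zero hW ha
  map_frob a := by
    have h : G.hom.appLE W W (G.le_preimage W) ≫ L.incl.app W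
        = L.incl.app W ≫ (absoluteFrobenius p X (isCharPScheme_of_hom p f)).app _ := by
      rw [Scheme.Hom.app_eq_appLE, Scheme.Hom.app_eq_appLE, Scheme.Hom.appLE_comp_appLE,
        Scheme.Hom.appLE_comp_appLE]
      simp only [G.restrict]
      rfl
    exact ConcreteCategory.congr_hom h a

end FrobeniusLifting
end Lifting

/-! ### Normal schemes locally of finite type -/

section Normal

theorem exists_forall_mul_eq_zero {A S : Type*} [CommRing A] [IsNoetherianRing A] [CommRing S]
    [Algebra A S] (M : Submonoid A) [IsLocalization M S] :
    ∃ m ∈ M, ∀ a : A, algebraMap A S a = 0 → m * a = 0 := by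
  obtain ⟨s, hs⟩ := (IsNoetherian.noetherian (RingHom.ker (algebraMap A S)) : Ideal.FG _)
  have hex (a : A) : ∃ m ∈ M, algebraMap A S a = 0 → m * a = 0 := by
    by_cases ha : algebraMap A S a = 0
    · obtain ⟨m, hm⟩ := (IsLocalization.map_eq_zero_iff M S a).mp ha
      exact ⟨m, m.2, fun _ => hm⟩
    · exact ⟨1, M.one_mem, fun h => absurd h ha⟩
  choose m hmM hm using hex
  have hle : RingHom.ker (algebraMap A S) ≤ LinearMap.ker (LinearMap.mulLeft A (∏ a ∈ s, m a)) := by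
    rw [← hs, Submodule.span_le]
    intro a ha
    have h0 : a ∈ RingHom.ker (algebraMap A S) := hs ▸ Submodule.subset_span ha
    obtain ⟨c, hc⟩ := Finset.dvd_prod_of_mem m ha
    change (∏ a ∈ s, m a) * a = 0
    rw [hc, mul_right_comm, hm a h0, zero_mul]
  exact ⟨∏ a ∈ s, m a, M.prod_mem fun a _ => hmM a, fun a ha => hle ha⟩

variable {X : Scheme.{u}} {U V : X.Opens}

theorem resHom_basicOpen_injective (hU : IsAffineOpen U) [IsDomain Γ(X, U)] {g : Γ(X, U)} {x : X}
    (hx : x ∈ X.basicOpen g) : Function.Injective (resHom (X.basicOpen_le g)) := by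
  have := hU.isLocalization_basicOpen g
  have hg : g ≠ 0 := by
    rintro rfl
    rw [Scheme.basicOpen_zero] at hx
    exact hx
  exact IsLocalization.injective (M := Submonoid.powers g) Γ(X, X.basicOpen g)
    (powers_le_nonZeroDivisors_of_noZeroDivisors hg)

theorem resHom_injective (hU : IsAffineOpen U) [IsDomain Γ(X, U)] (h : V ≤ U) {x : X}
    (hx : x ∈ V) : Function.Injective (resHom h) := by
  obtain ⟨g, hgV, hxg⟩ := hU.exists_basicOpen_le (⟨x, hx⟩ : V) (h hx)
  refine Function.Injective.of_comp (f := resHom hgV) ?_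
  convert resHom_basicOpen_injective hU hxg using 1
  funext a
  exact resHom_resHom _ _ _

theorem exists_resHom_mul_eq (hU : IsAffineOpen U) [IsDomain Γ(X, U)] (hV : IsAffineOpen V)
    [IsDomain Γ(X, V)] (h : V ≤ U) {x : X} (hx : x ∈ V) (b : Γ(X, V)) :
    ∃ a a' : Γ(X, U), a' ≠ 0 ∧ resHom h a' * b = resHom h a := by
  obtain ⟨g, hgV, hxg⟩ := hU.exists_basicOpen_le (⟨x, hx⟩ : V) (h hx)
  have := hU.isLocalization_basicOpen g
  have hg : g ≠ 0 := by
    rintro rfl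
    rw [Scheme.basicOpen_zero] at hxg
    exact hxg
  obtain ⟨⟨a, ⟨_, n, rfl⟩⟩, ha⟩ := IsLocalization.surj (Submonoid.powers g) (resHom hgV b)
  refine ⟨a, g ^ n, pow_ne_zero _ hg, resHom_injective hV hgV hxg ?_⟩
  rw [map_mul, resHom_resHom, resHom_resHom, mul_comm]
  exact ha

theorem isIntegrallyClosed_of_isNormalScheme [IsNormalScheme X] (hU : IsAffineOpen U)
    [IsDomain Γ(X, U)] : IsIntegrallyClosed Γ(X, U) := by
  refine IsIntegrallyClosed.of_localization_maximal fun P _ hP => ?_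
  let y : PrimeSpectrum Γ(X, U) := ⟨P, hP.isPrime⟩
  have hy : hU.fromSpec y ∈ U := by
    have : hU.fromSpec y ∈ Set.range hU.fromSpec := ⟨y, rfl⟩
    rwa [hU.range_fromSpec] at this
  let _ := X.presheaf.algebra_section_stalk ⟨hU.fromSpec y, hy⟩
  have : IsLocalization P.primeCompl (X.presheaf.stalk (hU.fromSpec y)) :=
    hU.isLocalization_stalk' y hy
  have := IsNormalScheme.isDomain_stalk (hU.fromSpec y)
  have := IsNormalScheme.isIntegrallyClosed_stalk (hU.fromSpec y)
  exact IsIntegrallyClosed.of_equiv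
    (IsLocalization.algEquiv P.primeCompl (X.presheaf.stalk (hU.fromSpec y))
      (Localization.AtPrime P)).toRingEquiv

variable {k : Type u} [Field k]

theorem finiteType_sections (f : X ⟶ Spec (.of k)) [LocallyOfFiniteType f]
    (hU : IsAffineOpen U) : ∃ φ : k →+* Γ(X, U), φ.FiniteType := by
  refine ⟨(f.appLE ⊤ U le_top).hom.comp
    (W2Lifting.sectionsEquiv (.of k)).symm.toRingHom, RingHom.FiniteType.comp ?_ ?_⟩
  · exact f.finiteType_appLE (isAffineOpen_top _) hU _
  · exact RingHom.FiniteType.of_surjective _ (W2Lifting.sectionsEquiv (.of k)).symm.surjective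

theorem isNoetherianRing_sections (f : X ⟶ Spec (.of k)) [LocallyOfFiniteType f]
    (hU : IsAffineOpen U) : IsNoetherianRing Γ(X, U) := by
  obtain ⟨φ, hφ⟩ := finiteType_sections f hU
  algebraize [φ]
  exact Algebra.FiniteType.isNoetherianRing k _

theorem isFFinite_sections [CharP k p] [PerfectField k] (f : X ⟶ Spec (.of k))
    [LocallyOfFiniteType f] (hU : IsAffineOpen U) [CharP Γ(X, U) p] : IsFFinite p Γ(X, U) := by
  obtain ⟨φ, hφ⟩ := finiteType_sections f hU
  algebraize [φ]
  exact isFFinite_of_finiteType (k := k)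

/-- The kernel of the map to the stalk is finitely generated, so one `g` invertible at `x` kills it.
After inverting `g`, the ring embeds in the stalk, a domain. -/
theorem exists_basicOpen_isDomain [IsNormalScheme X] (hU : IsAffineOpen U)
    [IsNoetherianRing Γ(X, U)] {x : X} (hx : x ∈ U) :
    ∃ g : Γ(X, U), x ∈ X.basicOpen g ∧ IsDomain Γ(X, X.basicOpen g) := by
  let _ := X.presheaf.algebra_section_stalk ⟨x, hx⟩
  have := hU.isLocalization_stalk ⟨x, hx⟩
  have := IsNormalScheme.isDomain_stalk x
  obtain ⟨g, hg, hmul⟩ := exists_forall_mul_eq_zero (S := X.presheaf.stalk x)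
    (hU.primeIdealOf ⟨x, hx⟩).asIdeal.primeCompl
  have hxg : x ∈ X.basicOpen g := by
    rw [Scheme.mem_basicOpen _ _ _ hx]
    exact IsLocalization.map_units (X.presheaf.stalk x)
      (⟨g, hg⟩ : (hU.primeIdealOf ⟨x, hx⟩).asIdeal.primeCompl)
  refine ⟨g, hxg, Function.Injective.isDomain (X.presheaf.germ (X.basicOpen g) x hxg).hom ?_⟩
  rw [injective_iff_map_eq_zero]
  intro b hb
  have := hU.isLocalization_basicOpen g
  obtain ⟨⟨a, ⟨m, hm⟩⟩, ha⟩ := IsLocalization.surj (Submonoid.powers g) b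
  have hunit := IsLocalization.map_units Γ(X, X.basicOpen g) (⟨m, hm⟩ : Submonoid.powers g)
  have hgunit := IsLocalization.map_units Γ(X, X.basicOpen g)
    (⟨g, Submonoid.mem_powers g⟩ : Submonoid.powers g)
  dsimp only at ha
  have hstalk : algebraMap Γ(X, U) (X.presheaf.stalk x) a = 0 := by
    have h1 := congrArg (X.presheaf.germ (X.basicOpen g) x hxg).hom ha
    rw [map_mul, hb, zero_mul] at h1
    exact (X.presheaf.germ_res_apply (homOfLE (X.basicOpen_le g)) x hxg a).symm.trans h1.symm
  have h2 := congrArg (algebraMap Γ(X, U) Γ(X, X.basicOpen g)) (hmul a hstalk)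
  rw [map_mul, map_zero, hgunit.mul_right_eq_zero] at h2
  rwa [h2, hunit.mul_left_eq_zero] at ha

end Normal

end

/-! ### Gluing the local splittings on `X` -/

section
variable {p : ℕ} [hp : Fact p.Prime] {k : Type u} [Field k] [CharP k p] [PerfectField k]
  {X : Scheme.{u}} {f : X ⟶ Spec (.of k)}

theorem W2Lifting.exists_isDomain (L : W2Lifting p f) [LocallyOfFiniteType f] [IsNormalScheme X]
    (U : X.Opens) {x : X} (hx : x ∈ U) : ∃ W : L.total.Opens,
      (IsAffineOpen W ∧ IsDomain Γ(X, L.incl ⁻¹ᵁ W)) ∧ x ∈ L.incl ⁻¹ᵁ W ∧ L.incl ⁻¹ᵁ W ≤ U := by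
  obtain ⟨W', hW', hU⟩ := L.incl.isClosedEmbedding.isInducing.isOpen_iff.mp U.isOpen
  obtain ⟨_, ⟨W, hW, rfl⟩, hxW, hle⟩ :=
    L.total.isBasis_affineOpens.exists_subset_of_mem_open (a := L.incl x) (u := W')
      (show x ∈ L.incl ⁻¹' W' by rw [hU]; exact hx) hW'
  have hWU : L.incl ⁻¹ᵁ W ≤ U := fun y hy => by
    change y ∈ (U : Set X)
    rw [← hU]
    exact hle hy
  have hWX : IsAffineOpen (L.incl ⁻¹ᵁ W) := L.isAffineOpen_preimage hW
  have := isNoetherianRing_sections f hWX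
  obtain ⟨g, hxg, hg⟩ := exists_basicOpen_isDomain hWX (x := x) hxW
  -- Lifting `g` makes its basic open the trace of an affine open of the lifting, as needed to
  -- define `δ` there.
  obtain ⟨t, rfl⟩ := L.incl.app_surjective W hW g
  have ht : L.incl ⁻¹ᵁ L.total.basicOpen t = X.basicOpen (L.incl.app W t) :=
    Scheme.preimage_basicOpen _ _
  refine ⟨L.total.basicOpen t, ⟨IsAffineOpen.basicOpen hW t, ?_⟩, ?_⟩
  · rwa [ht]
  · rw [ht]
    exact ⟨hxg, (X.basicOpen_le _).trans hWU⟩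

theorem FrobeniusLifting.exists_delta_map {L : W2Lifting p f} (G : FrobeniusLifting L)
    {W V : L.total.Opens} (hW : IsAffineOpen W) (hV : IsAffineOpen V)
    (h : L.incl ⁻¹ᵁ V ≤ L.incl ⁻¹ᵁ W) [CharP Γ(X, L.incl ⁻¹ᵁ V) p] (a : Γ(X, L.incl ⁻¹ᵁ W)) :
    ∃ c, (G.ringFrobLift hV).delta (resHom h a)
      = resHom h ((G.ringFrobLift hW).delta a) + c ^ p := by
  have hVW : V ≤ W := L.le_of_preimage_le h
  refine (G.ringFrobLift hW).delta_map (G.ringFrobLift hV) (resHom hVW) (resHom h)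
    (fun a => ?_) (fun a => ?_) a
  · exact ConcreteCategory.congr_hom (L.incl.naturality (homOfLE hVW).op) a
  · have h1 : L.total.presheaf.map (homOfLE hVW).op ≫ G.hom.appLE V V (G.le_preimage V)
        = G.hom.appLE W W (G.le_preimage W) ≫ L.total.presheaf.map (homOfLE hVW).op := by
      rw [Scheme.Hom.map_appLE, Scheme.Hom.appLE_map]
    exact ConcreteCategory.congr_hom h1 a

theorem FrobeniusLifting.isFrobeniusSplit [LocallyOfFiniteType f] [IsNormalScheme X]
    {L : W2Lifting p f} (G : FrobeniusLifting L) : IsFrobeniusSplit p X := by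
  have hX := isCharPScheme_of_hom p f
  let ι := {W : L.total.Opens // IsAffineOpen W ∧ IsDomain Γ(X, L.incl ⁻¹ᵁ W)}
  have hdom (i : ι) : IsDomain Γ(X, L.incl ⁻¹ᵁ i.1) := i.2.2
  have haff (i : ι) : IsAffineOpen (L.incl ⁻¹ᵁ i.1) := L.isAffineOpen_preimage i.2.1
  have hchar (i : ι) : CharP Γ(X, L.incl ⁻¹ᵁ i.1) p :=
    (CharP.charP_iff_prime_eq_zero hp.out).mpr (hX.natCast_eq_zero _)
  have hchar' (i : ι) : CharP (FractionRing Γ(X, L.incl ⁻¹ᵁ i.1)) p :=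
    charP_of_injective_algebraMap (IsFractionRing.injective Γ(X, L.incl ⁻¹ᵁ i.1) _) p
  have hfin (i : ι) : IsFFinite p Γ(X, L.incl ⁻¹ᵁ i.1) := isFFinite_sections f (haff i)
  have hsplit (i : ι) : ∃ φ, IsSplit p (G.ringFrobLift i.2.1).delta φ :=
    have := isNoetherianRing_sections f (haff i)
    have := isIntegrallyClosed_of_isNormalScheme (haff i)
    exists_isSplit (hfin i) (G.ringFrobLift i.2.1).isFrobDelta
  choose φ hφ using hsplit
  refine isFrobeniusSplit_of_basis (W := fun i : ι => L.incl ⁻¹ᵁ i.1) (fun U x hx => ?_) hX φ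
    (fun i => (hφ i).map_add (hfin i)) (fun i => (hφ i).map_pow_mul (hfin i))
    (fun i => (hφ i).map_one (hfin i)) fun i j h a => ?_
  · obtain ⟨W, hW, hWU⟩ := L.exists_isDomain U hx
    exact ⟨⟨W, hW⟩, hWU⟩
  -- The smaller open is nonempty because its ring is a domain; a point in it makes restriction
  -- injective and the extension birational.
  · obtain ⟨x, hx⟩ : ((L.incl ⁻¹ᵁ j.1 : X.Opens) : Set X).Nonempty := by
      rw [Set.nonempty_iff_ne_empty]
      intro h0
      have : L.incl ⁻¹ᵁ j.1 = ⊥ := TopologicalSpace.Opens.ext h0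
      have hs : Subsingleton Γ(X, L.incl ⁻¹ᵁ j.1) := by
        rw [this]
        infer_instance
      exact not_subsingleton _ hs
    exact (hφ i).comp_eq (hfin i) (hφ j) (resHom h) (resHom_injective (haff i) h hx)
      (exists_resHom_mul_eq (haff i) (haff j) h hx) (G.exists_delta_map i.2.1 j.2.1 h) a

end

end FrobLift

end

theorem mainTheorem7 (p : ℕ) [Fact p.Prime] (k : Type u) [Field k] [CharP k p] [PerfectField k]
    (X : Scheme.{u}) (f : X ⟶ Spec (.of k)) [LocallyOfFiniteType f] [FrobLift.IsNormalScheme X]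
    (h : ∃ L : FrobLift.W2Lifting p f, Nonempty (FrobLift.FrobeniusLifting L)) :
    FrobLift.IsFrobeniusSplit p X := by
  obtain ⟨_, ⟨G⟩⟩ := h
  exact G.isFrobeniusSplit
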